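/- **Setting.** Let $R$ be a ring with an exhaustive and separated filtration $FR=(F_nR)_{n\in\mathbb Z}$ (ascending, $1\in F_0R$, $F_nR\,F_mR\subset F_{n+m}R$) which is (left) Zariskian: the Rees ring $\widetilde R=\bigoplus_n F_nR$ is left Noetherian and $F_{-1}R$ is contained in the Jacobson radical of $F_0R$. Let $X\in\widetilde R$ be the central element of degree $1$ given by $1\in F_1R$, let $G(R)=\bigoplus_n F_nR/F_{n-1}R$ and let $\pi:\widetilde R\to G(R)$ be the canonical map. Let $M$ be a left $R$-module with an exhaustive and separated filtration $FM$ ($F_nR\,F_mM\subset F_{n+m}M$), Rees module $\widetilde M=\bigoplus_nF_nM$ and associated graded module $G(M)$. For a left ideal $I$ of $R$ put $F_nI=I\cap F_nR$ and $\widetilde I=\bigoplus_n F_nI$. A kernel functor $\lambda$ on the left modules over a ring $A$ is given by its Gabriel filter $\mathcal L(\lambda)$ of left ideals; $\lambda(N)$ is the set of elements of $N$ annihilated by some $I\in\mathcal L(\lambda)$, $Q_\lambda(N)=\varinjlim_{I\in\mathcal L(\lambda)}\mathrm{Hom}_A(I,N/\lambda(N))$ is the module of quotients and $j_\lambda:N\to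 Q_\lambda(N)$ is the localization morphism; $Q_\lambda(A)$ is a ring and $Q_\lambda(N)$ is a $Q_\lambda(A)$-module. If $A$ and $N$ are graded, then $Q^g_\lambda(N)=\bigoplus_n Q^g_\lambda(N)_n$, where $Q^g_\lambda(N)_n\subset Q_\lambda(N)$ consists of the elements given by homomorphisms of degree $n$ from graded $I\in\mathcal L(\lambda)$ to $N/\lambda(N)$. Let $\widetilde\kappa$ be a graded kernel functor on $\widetilde R$-modules ($\mathcal L(\widetilde\kappa)$ has a basis of graded left ideals). It induces the kernel functor $\kappa$ on $R$-modules with $\mathcal L(\kappa)=\{I\subset R:\widetilde I\in\mathcal L(\widetilde\kappa)\}$ and the kernel functor $\overline\kappa$ on $G(R)$-modules with $\mathcal L(\overline\kappa)=\{L\subset G(R): L\supset\pi(I)\text{ for some }I\in\mathcal L(\widetilde\kappa)\}$. One says that $\widetilde\kappa$ is *affine* if $\widetilde RX\in\mathcal L(\widetilde\kappa)$, and *pseudo-affine* if the $\widetilde I$ with $I\in\mathcal L(\kappa)$ form a basis of $\mathcal L(\widetilde\kappa)$. A filtered module $N$ is *$\kappa$-separated* if for all $n$, all $m\in F_nN\setminus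 F_{n-1}N$ and all $I\in\mathcal L(\kappa)$ such that $(F_\gamma I)m\subset F_{\gamma+n-1}N$ for all $\gamma\in\mathbb Z$, one has $m\in\kappa(N)$. The *quotient filtration* on $Q_\kappa(M)$ is $$F_nQ_\kappa(M)=\{q:\ \exists I\in\mathcal L(\kappa)\ \forall p\in\mathbb Z:\ (F_pI)\,q\subset j_\kappa(F_{p+n}M)\},$$ and similarly for $Q_\kappa(R)$. A map $f:N\to N'$ is *strict filtered* if $f(F_nN)=f(N)\cap F_nN'$ for all $n$. $M/\kappa(M)$ carries the induced filtration. **Theorem.** Consider the condition (H$_M$) either $\widetilde\kappa$ is pseudo-affine and $M$ is $\kappa$-separated, or $\widetilde\kappa$ is affine and $M/\kappa(M)$ is $\kappa$-separated. 1. If (H$_M$) holds, then $FQ_\kappa(M)$ is an exhaustive filtration of the filtered $R$-module $Q_\kappa(M)$, the morphism $j_\kappa:M\to Q_\kappa(M)$ is strict filtered, and $F_aQ_\kappa(R)\,F_bQ_\kappa(M)\subset F_{a+b}Q_\kappa(M)$ for all $a,b$. If (H$_R$) holds, then $FQ_\kappa(R)$ is an exhaustive ring filtration of $Q_\kappa(R)$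 and $j_\kappa:R\to Q_\kappa(R)$ is strict filtered and a ring morphism. 2. If (H$_M$) holds and $\widetilde\kappa$ is pseudo-affine, then $Q_\kappa(M)^\sim=Q^g_{\widetilde\kappa}(\widetilde M)$: there is an isomorphism of graded $\widetilde R$-modules between them that is compatible with the canonical maps from $\widetilde M$. 3. If (H$_M$) holds and $\widetilde\kappa$ is pseudo-affine, then $G(Q_\kappa(M))\subset Q^g_{\overline\kappa}(G(M))$: there is an injective homomorphism of graded $G(R)$-modules from the first to the second that is compatible with the canonical maps from $G(M)$. -/

import Mathlib

open DirectSum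

namespace FilteredLocalization

/-! ### Localization at a kernel functor, given by its Gabriel filter -/

section Localization

variable {A : Type*} [Ring A] (κ : IdealFilter A) [κ.IsGabriel]
variable (M : Type*) [AddCommGroup M] [Module A M]

/-- The torsion submodule `κ(M)`: the elements annihilated by some left ideal of the filter. -/
def torsion : Submodule A M where
  carrier := {m | κ.IsTorsionElem m}
  zero_mem' := by
    obtain ⟨J, hJ⟩ := κ.nonempty
    exact ⟨J, hJ, fun a _ => smul_zero a⟩
  add_mem' := by
    rintro x y ⟨I, hI, hx⟩ ⟨J, hJ, hy⟩
    refine ⟨I ⊓ J, Order.PFilter.inf_mem hI hJ, fun a ha => ?_⟩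
    rw [smul_add, hx a ha.1, hy a ha.2, add_zero]
  smul_mem' := by
    rintro c x ⟨I, hI, hx⟩
    refine ⟨I.colon {c}, IdealFilter.IsUniform.colon_mem hI c, fun a ha => ?_⟩
    rw [smul_smul]
    exact hx _ (Submodule.mem_colon_singleton.mp ha)

variable {M}

theorem mem_torsion {m : M} : m ∈ torsion κ M ↔ ∃ I ∈ κ, ∀ a ∈ I, a • m = 0 := Iff.rfl

theorem mem_torsion_of_smul_mem {m : M} {I : Ideal A} (hI : I ∈ κ)
    (h : ∀ a ∈ I, a • m ∈ torsion κ M) : m ∈ torsion κ M := by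
  have key : (⊥ : Submodule A M).colon {m} ∈ κ := by
    refine IdealFilter.IsGabriel.gabriel_closed _ ⟨I, hI, fun a ha => ?_⟩
    obtain ⟨K, hK, hKa⟩ := h a ha
    refine Order.PFilter.mem_of_le (fun b hb => ?_) hK
    rw [Submodule.mem_colon_singleton, Submodule.mem_colon_singleton, smul_eq_mul, mul_smul,
      hKa b hb]
    exact zero_mem _
  exact ⟨_, key, fun a ha => by simpa using Submodule.mem_colon_singleton.mp ha⟩

theorem eq_zero_of_torsion_quotient {x : M ⧸ torsion κ M} {I : Ideal A} (hI : I ∈ κ)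
    (h : ∀ a ∈ I, a • x = 0) : x = 0 := by
  obtain ⟨m, rfl⟩ := Submodule.Quotient.mk_surjective _ x
  rw [Submodule.Quotient.mk_eq_zero]
  refine mem_torsion_of_smul_mem κ hI fun a ha => ?_
  rw [← Submodule.Quotient.mk_eq_zero, Submodule.Quotient.mk_smul]
  exact h a ha

variable (M)

/-- Linear maps `I → M / κ(M)` with `I` in the filter. -/
def PartialHoms : AddSubmonoid (A →ₗ.[A] (M ⧸ torsion κ M)) where
  carrier := {f | f.domain ∈ κ}
  zero_mem' := Order.PFilter.top_mem
  add_mem' := fun hf hg => Order.PFilter.inf_mem hf hg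

/-- Two such maps are identified when they agree on some left ideal of the filter. -/
def partialHomsCon : AddCon (PartialHoms κ M) where
  r f g := f.1.eqLocus g.1 ∈ κ
  iseqv :=
    { refl := fun f => Order.PFilter.mem_of_le (fun x hx => ⟨hx, hx, rfl⟩) f.2
      symm := fun {f g} h =>
        Order.PFilter.mem_of_le
          (by rintro x ⟨h1, h2, h3⟩; exact ⟨h2, h1, h3.symm⟩) h
      trans := fun {f g k} h h' =>
        Order.PFilter.mem_of_le
          (by rintro x ⟨⟨h1, _, h3⟩, ⟨_, h5, h6⟩⟩; exact ⟨h1, h5, h3.trans h6⟩)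
          (Order.PFilter.inf_mem h h') }
  add' := fun {f g k l} h h' =>
    Order.PFilter.mem_of_le
      (by
        rintro x ⟨⟨h1, h2, h3⟩, ⟨h4, h5, h6⟩⟩
        refine ⟨⟨h1, h4⟩, ⟨h2, h5⟩, ?_⟩
        exact congrArg₂ (· + ·) h3 h6)
      (Order.PFilter.inf_mem h h')

/-- The module of quotients `Q_κ(M)`, the direct limit of `Hom(I, M / κ(M))` over the left
ideals `I` of the filter. -/
def Q : Type _ := (partialHomsCon κ M).Quotient

namespace Q

variable {M}

noncomputable instance : AddCommMonoid (Q κ M) :=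
  inferInstanceAs (AddCommMonoid (partialHomsCon κ M).Quotient)

/-- The class of a linear map defined on a left ideal of the filter. -/
def mk (f : A →ₗ.[A] (M ⧸ torsion κ M)) (hf : f.domain ∈ κ) : Q κ M :=
  ((⟨f, hf⟩ : PartialHoms κ M) : (partialHomsCon κ M).Quotient)

theorem mk_eq_mk {f g : A →ₗ.[A] (M ⧸ torsion κ M)} {hf : f.domain ∈ κ} {hg : g.domain ∈ κ} :
    mk κ f hf = mk κ g hg ↔ f.eqLocus g ∈ κ :=
  AddCon.eq _

theorem exists_mk (x : Q κ M) : ∃ f hf, x = mk κ f hf := by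
  induction x using AddCon.induction_on with
  | H f => exact ⟨f.1, f.2, rfl⟩

theorem mk_add_mk {f g : A →ₗ.[A] (M ⧸ torsion κ M)} (hf : f.domain ∈ κ) (hg : g.domain ∈ κ) :
    mk κ f hf + mk κ g hg = mk κ (f + g) (Order.PFilter.inf_mem hf hg) := rfl

theorem zero_domain_mem : (0 : A →ₗ.[A] (M ⧸ torsion κ M)).domain ∈ κ := Order.PFilter.top_mem

theorem zero_eq_mk : (0 : Q κ M) = mk κ 0 (zero_domain_mem κ) := rfl

theorem exists_add_eq_zero (x : Q κ M) : ∃ y : Q κ M, y + x = 0 := by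
  obtain ⟨f, hf, rfl⟩ := exists_mk κ x
  refine ⟨mk κ (-f) hf, ?_⟩
  rw [mk_add_mk, zero_eq_mk, mk_eq_mk]
  refine Order.PFilter.mem_of_le (fun x hx => ⟨⟨hx, hx⟩, Submodule.mem_top, ?_⟩) hf
  exact neg_add_cancel (f ⟨x, hx⟩)

noncomputable instance : Neg (Q κ M) where
  neg x := (exists_add_eq_zero κ x).choose

noncomputable instance : AddCommGroup (Q κ M) :=
  { (inferInstance : AddCommMonoid (Q κ M)), (inferInstance : Neg (Q κ M)) with
    zsmul := zsmulRec
    neg_add_cancel := fun x => (exists_add_eq_zero κ x).choose_spec }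

/-- For `f : I → M / κ(M)` and `c` in `A`, the map `a ↦ f (a c)`, defined on `(I : c)`. -/
def shift (c : A) (f : A →ₗ.[A] (M ⧸ torsion κ M)) : A →ₗ.[A] (M ⧸ torsion κ M) where
  domain := f.domain.colon {c}
  toFun :=
    { toFun := fun a => f ⟨a.1 * c, Submodule.mem_colon_singleton.mp a.2⟩
      map_add' := fun a b => by
        rw [← LinearPMap.map_add]
        congr 1
        exact Subtype.ext (add_mul _ _ _)
      map_smul' := fun r a => by
        rw [RingHom.id_apply, ← LinearPMap.map_smul]
        congr 1
        exact Subtype.ext (mul_assoc _ _ _) }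

theorem shift_domain_mem (c : A) {f : A →ₗ.[A] (M ⧸ torsion κ M)} (hf : f.domain ∈ κ) :
    (shift κ c f).domain ∈ κ :=
  IdealFilter.IsUniform.colon_mem hf c

theorem mk_eq_mk_of {f g : A →ₗ.[A] (M ⧸ torsion κ M)} {hf : f.domain ∈ κ} {hg : g.domain ∈ κ}
    {I : Ideal A} (hI : I ∈ κ)
    (h : ∀ a ∈ I, ∃ (h₁ : a ∈ f.domain) (h₂ : a ∈ g.domain), f ⟨a, h₁⟩ = g ⟨a, h₂⟩) :
    mk κ f hf = mk κ g hg :=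
  (mk_eq_mk κ).mpr (Order.PFilter.mem_of_le h hI)

/-- Scalar multiplication on `Q_κ(M)`: the class of `f` is sent to the class of `a ↦ f (a c)`. -/
noncomputable def smulHom (c : A) : Q κ M →+ Q κ M :=
  (partialHomsCon κ M).lift
    { toFun := fun f => mk κ (shift κ c f.1) (shift_domain_mem κ c f.2)
      map_zero' := mk_eq_mk_of κ Order.PFilter.top_mem fun _ _ =>
        ⟨Submodule.mem_colon_singleton.mpr Submodule.mem_top, Submodule.mem_top, rfl⟩
      map_add' := fun f g => mk_eq_mk_of κ
        (Order.PFilter.inf_mem (shift_domain_mem κ c f.2) (shift_domain_mem κ c g.2))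
        fun a ha => by
          have h1 := Submodule.mem_colon_singleton.mp ha.1
          have h2 := Submodule.mem_colon_singleton.mp ha.2
          exact ⟨Submodule.mem_colon_singleton.mpr ⟨h1, h2⟩, ha, rfl⟩ }
    (fun f g h => mk_eq_mk_of κ (IdealFilter.IsUniform.colon_mem h c) fun a ha => by
      obtain ⟨h1, h2, h3⟩ := Submodule.mem_colon_singleton.mp ha
      exact ⟨Submodule.mem_colon_singleton.mpr h1, Submodule.mem_colon_singleton.mpr h2, h3⟩)

theorem smulHom_mk (c : A) {f : A →ₗ.[A] (M ⧸ torsion κ M)} (hf : f.domain ∈ κ) :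
    smulHom κ c (mk κ f hf) = mk κ (shift κ c f) (shift_domain_mem κ c hf) := rfl

theorem apply_congr {f : A →ₗ.[A] (M ⧸ torsion κ M)} {a b : A} (h : a = b) (ha : a ∈ f.domain) :
    f ⟨a, ha⟩ = f ⟨b, h ▸ ha⟩ := by subst h; rfl

noncomputable instance : Module A (Q κ M) where
  smul c := smulHom κ c
  one_smul x := by
    obtain ⟨f, hf, rfl⟩ := exists_mk κ x
    refine mk_eq_mk_of κ hf fun a ha => ⟨?_, ha, apply_congr κ (mul_one a) _⟩
    exact Submodule.mem_colon_singleton.mpr (by rwa [smul_eq_mul, mul_one])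
  mul_smul c d x := by
    obtain ⟨f, hf, rfl⟩ := exists_mk κ x
    refine mk_eq_mk_of κ (shift_domain_mem κ (c * d) hf) fun a ha => ⟨ha, ?_, ?_⟩
    · have := Submodule.mem_colon_singleton.mp ha
      refine Submodule.mem_colon_singleton.mpr (Submodule.mem_colon_singleton.mpr ?_)
      rwa [smul_eq_mul, smul_eq_mul, mul_assoc]
    · exact apply_congr κ (mul_assoc a c d).symm _
  smul_zero c := map_zero (smulHom κ c)
  smul_add c := map_add (smulHom κ c)
  add_smul c d x := by
    obtain ⟨f, hf, rfl⟩ := exists_mk κ x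
    refine mk_eq_mk_of κ
      (Order.PFilter.inf_mem (shift_domain_mem κ c hf) (shift_domain_mem κ d hf))
      fun a ha => ?_
    have h1 : a * c ∈ f.domain := Submodule.mem_colon_singleton.mp ha.1
    have h2 : a * d ∈ f.domain := Submodule.mem_colon_singleton.mp ha.2
    have h3 : a * (c + d) ∈ f.domain := by rw [mul_add]; exact add_mem h1 h2
    refine ⟨Submodule.mem_colon_singleton.mpr h3, ha, ?_⟩
    exact (apply_congr κ (mul_add a c d) h3).trans (f.map_add ⟨_, h1⟩ ⟨_, h2⟩)
  zero_smul x := by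
    obtain ⟨f, hf, rfl⟩ := exists_mk κ x
    have h : ∀ a : A, a * 0 ∈ f.domain := fun a => by rw [mul_zero]; exact zero_mem _
    refine mk_eq_mk_of κ Order.PFilter.top_mem fun a _ =>
      ⟨Submodule.mem_colon_singleton.mpr (h a), Submodule.mem_top, ?_⟩
    exact (apply_congr κ (mul_zero a) (h a)).trans f.map_zero

theorem smul_mk (c : A) {f : A →ₗ.[A] (M ⧸ torsion κ M)} (hf : f.domain ∈ κ) :
    c • mk κ f hf = mk κ (shift κ c f) (shift_domain_mem κ c hf) := rfl

/-- The map `a ↦ a x` on all of `A`. -/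
def total (x : M ⧸ torsion κ M) : A →ₗ.[A] (M ⧸ torsion κ M) :=
  (LinearMap.toSpanSingleton A _ x).toPMap ⊤

theorem total_domain_mem (x : M ⧸ torsion κ M) : (total κ x).domain ∈ κ := Order.PFilter.top_mem

/-- The embedding of `M / κ(M)` in `Q_κ(M)`: `x` is sent to the class of `a ↦ a x` on `A`. -/
noncomputable def ofQuotient : (M ⧸ torsion κ M) →ₗ[A] Q κ M where
  toFun x := mk κ (total κ x) (total_domain_mem κ x)
  map_add' x y := mk_eq_mk_of κ Order.PFilter.top_mem fun a _ =>
    ⟨Submodule.mem_top, ⟨Submodule.mem_top, Submodule.mem_top⟩, smul_add a x y⟩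
  map_smul' c x := mk_eq_mk_of κ Order.PFilter.top_mem fun a _ =>
    ⟨Submodule.mem_top, Submodule.mem_colon_singleton.mpr Submodule.mem_top,
      (mul_smul a c x).symm⟩

theorem ofQuotient_apply (x : M ⧸ torsion κ M) :
    ofQuotient κ x = mk κ (total κ x) (total_domain_mem κ x) := rfl

theorem ofQuotient_injective : Function.Injective (ofQuotient κ (M := M)) := by
  rw [injective_iff_map_eq_zero]
  intro x hx
  rw [zero_eq_mk, ofQuotient_apply, mk_eq_mk] at hx
  refine eq_zero_of_torsion_quotient κ hx fun a ha => ?_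
  obtain ⟨_, _, h⟩ := ha
  exact h

theorem smul_mk_of_mem {f : A →ₗ.[A] (M ⧸ torsion κ M)} (hf : f.domain ∈ κ) (a : f.domain) :
    (a : A) • mk κ f hf = ofQuotient κ (f a) := by
  rw [smul_mk, ofQuotient_apply]
  refine mk_eq_mk_of κ Order.PFilter.top_mem fun b _ =>
    ⟨Submodule.mem_colon_singleton.mpr (f.domain.smul_mem b a.2), Submodule.mem_top, ?_⟩
  exact f.map_smul b a

theorem eq_zero_of_forall_smul {x : Q κ M} {I : Ideal A} (hI : I ∈ κ)
    (h : ∀ a ∈ I, a • x = 0) : x = 0 := by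
  obtain ⟨f, hf, rfl⟩ := exists_mk κ x
  rw [zero_eq_mk]
  refine mk_eq_mk_of κ (Order.PFilter.inf_mem hI hf) fun a ha =>
    ⟨ha.2, Submodule.mem_top, ofQuotient_injective κ ?_⟩
  rw [← smul_mk_of_mem κ hf ⟨a, ha.2⟩, h a ha.1]
  exact (map_zero (ofQuotient κ)).symm

theorem eq_of_forall_smul {x y : Q κ M} {I : Ideal A} (hI : I ∈ κ)
    (h : ∀ a ∈ I, a • x = a • y) : x = y :=
  sub_eq_zero.mp (eq_zero_of_forall_smul κ hI fun a ha => by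
    rw [smul_sub, h a ha, sub_self])

theorem exists_smul_mem_range (x : Q κ M) :
    ∃ I ∈ κ, ∀ a ∈ I, a • x ∈ LinearMap.range (ofQuotient κ (M := M)) := by
  obtain ⟨f, hf, rfl⟩ := exists_mk κ x
  exact ⟨f.domain, hf, fun a ha => ⟨_, (smul_mk_of_mem κ hf ⟨a, ha⟩).symm⟩⟩

/-- Linear maps from a left ideal of the filter to `Q_κ(M)` are given by an element. -/
theorem exists_smul_eq {I : Ideal A} (hI : I ∈ κ) (h : I →ₗ[A] Q κ M) :
    ∃ z : Q κ M, ∀ a : I, (a : A) • z = h a := by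
  let N : Submodule A (Q κ M) := LinearMap.range (ofQuotient κ (M := M))
  let P : Submodule A I := N.comap h
  let e := LinearEquiv.ofInjective (ofQuotient κ (M := M)) (ofQuotient_injective κ)
  let I' : Ideal A := P.map I.subtype
  have hI' : I' ∈ κ := by
    refine IdealFilter.IsGabriel.gabriel_closed _ ⟨I, hI, fun a ha => ?_⟩
    obtain ⟨K, hK, hKa⟩ := exists_smul_mem_range κ (h ⟨a, ha⟩)
    refine Order.PFilter.mem_of_le (fun b hb => Submodule.mem_colon_singleton.mpr ?_) hK
    refine ⟨b • ⟨a, ha⟩, ?_, rfl⟩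
    change h (b • ⟨a, ha⟩) ∈ N
    rw [map_smul]
    exact hKa b hb
  have hle : ∀ a ∈ I', ∃ ha : a ∈ I, h ⟨a, ha⟩ ∈ N := by
    rintro _ ⟨a, ha, rfl⟩
    exact ⟨a.2, ha⟩
  let k : I' →ₗ[A] (M ⧸ torsion κ M) :=
    e.symm.toLinearMap ∘ₗ
      (h ∘ₗ Submodule.inclusion (fun a ha => (hle a ha).1)).codRestrict N
        (fun a => (hle a a.2).2)
  have hk : ∀ (a : A) (ha : a ∈ I'),
      a • mk κ ⟨I', k⟩ hI' = h ⟨a, (hle a ha).1⟩ := by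
    intro a ha
    rw [smul_mk_of_mem κ (f := ⟨I', k⟩) hI' ⟨a, ha⟩]
    exact congrArg Subtype.val (e.apply_symm_apply ⟨h ⟨a, (hle a ha).1⟩, (hle a ha).2⟩)
  refine ⟨mk κ ⟨I', k⟩ hI', fun a => ?_⟩
  refine eq_of_forall_smul κ (IdealFilter.IsUniform.colon_mem hI' (a : A)) fun b hb => ?_
  have hb' : b * (a : A) ∈ I' := Submodule.mem_colon_singleton.mp hb
  rw [smul_smul, hk _ hb', ← map_smul]
  rfl

end Q

/-- The localization morphism `j_κ : M → Q_κ(M)`. -/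
noncomputable def loc : M →ₗ[A] Q κ M := Q.ofQuotient κ ∘ₗ (torsion κ M).mkQ

variable {M}

theorem loc_eq_zero_iff {m : M} : loc κ M m = 0 ↔ m ∈ torsion κ M := by
  rw [← Submodule.Quotient.mk_eq_zero (torsion κ M)]
  exact map_eq_zero_iff _ (Q.ofQuotient_injective κ)

theorem exists_smul_eq_loc (x : Q κ M) : ∃ I ∈ κ, ∀ a ∈ I, ∃ m, a • x = loc κ M m := by
  obtain ⟨I, hI, h⟩ := Q.exists_smul_mem_range κ x
  refine ⟨I, hI, fun a ha => ?_⟩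
  obtain ⟨y, hy⟩ := h a ha
  obtain ⟨m, rfl⟩ := Submodule.Quotient.mk_surjective _ y
  exact ⟨m, hy.symm⟩

namespace Q

theorem hom_ext {φ ψ : Q κ A →ₗ[A] Q κ M} (h : φ (loc κ A 1) = ψ (loc κ A 1)) : φ = ψ := by
  ext x
  obtain ⟨I, hI, hx⟩ := exists_smul_eq_loc κ x
  refine eq_of_forall_smul κ hI fun a ha => ?_
  obtain ⟨r, hr⟩ := hx a ha
  have hr' : loc κ A r = r • loc κ A 1 := by rw [← map_smul, smul_eq_mul, mul_one]
  rw [← map_smul, ← map_smul, hr, hr', map_smul, map_smul, h]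

theorem exists_hom (y : Q κ M) : ∃ φ : Q κ A →ₗ[A] Q κ M, φ (loc κ A 1) = y := by
  let g : (A ⧸ torsion κ A) →ₗ[A] Q κ M :=
    (torsion κ A).liftQ (LinearMap.toSpanSingleton A _ y) (by
      rintro r ⟨I, hI, hr⟩
      rw [LinearMap.mem_ker, LinearMap.toSpanSingleton_apply]
      refine eq_zero_of_forall_smul κ hI fun a ha => ?_
      rw [smul_smul, ← smul_eq_mul, hr a ha, zero_smul])
  have ex : ∀ x : Q κ A, ∃ z : Q κ M, ∃ I ∈ κ, ∀ a ∈ I, ∃ r : A ⧸ torsion κ A,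
      a • x = ofQuotient κ r ∧ a • z = g r := by
    intro x
    obtain ⟨f, hf, rfl⟩ := exists_mk κ x
    obtain ⟨z, hz⟩ := exists_smul_eq κ hf (g ∘ₗ f.toFun)
    exact ⟨z, f.domain, hf, fun a ha => ⟨f ⟨a, ha⟩, smul_mk_of_mem κ hf ⟨a, ha⟩, hz ⟨a, ha⟩⟩⟩
  choose φ hφ using ex
  have uniq : ∀ x z, (∃ I ∈ κ, ∀ a ∈ I, ∃ r : A ⧸ torsion κ A,
      a • x = ofQuotient κ r ∧ a • z = g r) → φ x = z := by
    rintro x z ⟨I, hI, h⟩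
    obtain ⟨J, hJ, h'⟩ := hφ x
    refine eq_of_forall_smul κ (Order.PFilter.inf_mem hI hJ) fun a ha => ?_
    obtain ⟨r, hr, hr'⟩ := h a ha.1
    obtain ⟨s, hs, hs'⟩ := h' a ha.2
    rw [hr', hs', ofQuotient_injective κ (hr.symm.trans hs)]
  refine ⟨{ toFun := φ, map_add' := fun x x' => ?_, map_smul' := fun c x => ?_ }, ?_⟩
  · obtain ⟨I, hI, h⟩ := hφ x
    obtain ⟨J, hJ, h'⟩ := hφ x'
    refine uniq _ _ ⟨_, Order.PFilter.inf_mem hI hJ, fun a ha => ?_⟩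
    obtain ⟨r, hr, hr'⟩ := h a ha.1
    obtain ⟨s, hs, hs'⟩ := h' a ha.2
    exact ⟨r + s, by rw [smul_add, hr, hs, map_add], by rw [smul_add, hr', hs', map_add]⟩
  · obtain ⟨I, hI, h⟩ := hφ x
    refine uniq _ _ ⟨_, IdealFilter.IsUniform.colon_mem hI c, fun a ha => ?_⟩
    obtain ⟨r, hr, hr'⟩ := h _ (Submodule.mem_colon_singleton.mp ha)
    exact ⟨r, by rw [smul_smul]; exact hr, by rw [RingHom.id_apply, smul_smul]; exact hr'⟩
  · refine uniq _ _ ⟨⊤, Order.PFilter.top_mem, fun a _ => ⟨Submodule.Quotient.mk a, ?_, ?_⟩⟩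
    · rw [← map_smul, smul_eq_mul, mul_one]
      rfl
    · rfl

/-- Right multiplication by `y` in `Q_κ(M)`: the unique `A`-linear map `Q_κ(A) → Q_κ(M)` that
sends `j_κ(1)` to `y`. -/
noncomputable def rightMul (y : Q κ M) : Q κ A →ₗ[A] Q κ M := (exists_hom κ y).choose

theorem rightMul_loc_one (y : Q κ M) : rightMul κ y (loc κ A 1) = y :=
  (exists_hom κ y).choose_spec

theorem rightMul_add (y z : Q κ M) : rightMul κ (y + z) = rightMul κ y + rightMul κ z :=
  hom_ext κ (by simp only [LinearMap.add_apply, rightMul_loc_one])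

theorem rightMul_zero : rightMul κ (0 : Q κ M) = 0 :=
  hom_ext κ (by rw [rightMul_loc_one, LinearMap.zero_apply])

theorem rightMul_loc_one_apply (x : Q κ A) : rightMul κ (loc κ A 1) x = x :=
  LinearMap.congr_fun (g := LinearMap.id) (hom_ext κ (rightMul_loc_one κ _)) x

theorem rightMul_rightMul (x y : Q κ A) (z : Q κ M) :
    rightMul κ z (rightMul κ y x) = rightMul κ (rightMul κ z y) x :=
  LinearMap.congr_fun (f := rightMul κ z ∘ₗ rightMul κ y) (hom_ext κ (by
    rw [LinearMap.comp_apply, rightMul_loc_one, rightMul_loc_one])) x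

/-- The ring of quotients `Q_κ(A)`. -/
noncomputable instance : Ring (Q κ A) :=
  { (inferInstance : AddCommGroup (Q κ A)) with
    mul := fun x y => rightMul κ y x
    one := loc κ A 1
    mul_assoc := fun x y z => rightMul_rightMul κ x y z
    one_mul := fun x => rightMul_loc_one κ x
    mul_one := fun x => rightMul_loc_one_apply κ x
    left_distrib := fun x y z => LinearMap.congr_fun (rightMul_add κ y z) x
    right_distrib := fun x y z => map_add (rightMul κ z) x y
    zero_mul := fun x => map_zero (rightMul κ x)
    mul_zero := fun x => LinearMap.congr_fun (rightMul_zero κ) x }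

/-- The `Q_κ(A)`-module `Q_κ(M)`. -/
noncomputable instance : Module (Q κ A) (Q κ M) where
  smul x y := rightMul κ y x
  one_smul y := rightMul_loc_one κ y
  mul_smul x y z := rightMul_rightMul κ x y z
  smul_zero x := LinearMap.congr_fun (rightMul_zero κ) x
  smul_add x y z := LinearMap.congr_fun (rightMul_add κ y z) x
  add_smul x y z := map_add (rightMul κ z) x y
  zero_smul x := map_zero (rightMul κ x)

theorem loc_smul (r : A) (y : Q κ M) : loc κ A r • y = r • y := by
  change rightMul κ y (loc κ A r) = r • y
  rw [show loc κ A r = r • loc κ A 1 by rw [← map_smul, smul_eq_mul, mul_one], map_smul,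
    rightMul_loc_one]

end Q

end Localization

/-! ### Graded kernel functors and graded localization -/

section Graded

variable {𝒜 : ℤ → Type*} [∀ i, AddCommGroup (𝒜 i)] [GRing 𝒜]

/-- A left ideal of a graded ring is graded if it contains the homogeneous components of its
elements. -/
def IsGradedIdeal (I : Ideal (⨁ i, 𝒜 i)) : Prop :=
  ∀ x ∈ I, ∀ i, of 𝒜 i (x i) ∈ I

/-- A kernel functor on a graded ring is graded if its filter has a basis of graded left ideals. -/
def IsGradedKernel (κ : IdealFilter (⨁ i, 𝒜 i)) : Prop :=
  ∀ J ∈ κ, ∃ I ∈ κ, IsGradedIdeal I ∧ I ≤ J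

theorem of_apply_mul_of (z : ⨁ i, 𝒜 i) {i : ℤ} (a : 𝒜 i) (p : ℤ) :
    of 𝒜 p (z p) * of 𝒜 i a = of 𝒜 (p + i) ((z * of 𝒜 i a) (p + i)) := by
  induction z using DirectSum.induction_on with
  | zero => rw [zero_mul, DirectSum.zero_apply, DirectSum.zero_apply, map_zero, map_zero, zero_mul]
  | of q b =>
    by_cases h : q = p
    · subst h
      rw [of_eq_same, of_mul_of, of_eq_same]
    · have h' : p + i ≠ q + i := fun h' => h (add_right_cancel h').symm
      rw [of_eq_of_ne _ _ _ (Ne.symm h), map_zero, zero_mul, of_mul_of, of_eq_of_ne _ _ _ h',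
        map_zero]
  | add x y hx hy =>
    rw [add_mul, DirectSum.add_apply, DirectSum.add_apply, map_add, map_add, add_mul, hx, hy]

theorem IsGradedIdeal.colon {I : Ideal (⨁ i, 𝒜 i)} (hI : IsGradedIdeal I) {i : ℤ} (a : 𝒜 i) :
    IsGradedIdeal (I.colon {of 𝒜 i a}) := fun z hz p => by
  rw [Submodule.mem_colon_singleton, smul_eq_mul, of_apply_mul_of]
  exact hI _ (Submodule.mem_colon_singleton.mp hz) _

variable (κ : IdealFilter (⨁ i, 𝒜 i)) [κ.IsGabriel]
variable (ℳ : ℤ → Type*) [∀ i, AddCommGroup (ℳ i)] [Gmodule 𝒜 ℳ]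

/-- The degree `n` part of the graded localization: the elements of `Q_κ(M)` given by
homomorphisms of degree `n` from a graded left ideal of the filter to `M / κ(M)`. -/
def gradedPiece (n : ℤ) : AddSubgroup (Q κ (⨁ i, ℳ i)) where
  carrier := {q | ∃ I ∈ κ, IsGradedIdeal I ∧ ∀ p (a : 𝒜 p), of 𝒜 p a ∈ I →
    ∃ m : ℳ (p + n), of 𝒜 p a • q = loc κ (⨁ i, ℳ i) (of ℳ (p + n) m)}
  zero_mem' := ⟨⊤, Order.PFilter.top_mem, fun _ _ _ => Submodule.mem_top, fun p a _ =>
    ⟨0, by rw [smul_zero, map_zero, map_zero]⟩⟩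
  add_mem' := by
    rintro x y ⟨I, hI, gI, hx⟩ ⟨J, hJ, gJ, hy⟩
    refine ⟨I ⊓ J, Order.PFilter.inf_mem hI hJ,
      fun z hz i => ⟨gI z hz.1 i, gJ z hz.2 i⟩, fun p a ha => ?_⟩
    obtain ⟨m, hm⟩ := hx p a ha.1
    obtain ⟨m', hm'⟩ := hy p a ha.2
    exact ⟨m + m', by rw [smul_add, hm, hm', map_add, map_add]⟩
  neg_mem' := by
    rintro x ⟨I, hI, gI, hx⟩
    refine ⟨I, hI, gI, fun p a ha => ?_⟩
    obtain ⟨m, hm⟩ := hx p a ha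
    exact ⟨-m, by rw [smul_neg, hm, map_neg, map_neg]⟩

theorem exists_of_eq {i j : ℤ} (h : i = j) (m : ℳ i) : ∃ m' : ℳ j, of ℳ i m = of ℳ j m' := by
  subst h
  exact ⟨m, rfl⟩

theorem smul_mem_gradedPiece {i n : ℤ} (a : 𝒜 i) {q : Q κ (⨁ i, ℳ i)}
    (hq : q ∈ gradedPiece κ ℳ n) : of 𝒜 i a • q ∈ gradedPiece κ ℳ (i + n) := by
  obtain ⟨I, hI, gI, h⟩ := hq
  refine ⟨_, IdealFilter.IsUniform.colon_mem hI (of 𝒜 i a), gI.colon a, fun p b hb => ?_⟩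
  have hb' := Submodule.mem_colon_singleton.mp hb
  rw [smul_eq_mul, of_mul_of] at hb'
  obtain ⟨m, hm⟩ := h _ _ hb'
  obtain ⟨m', hm'⟩ := exists_of_eq ℳ (add_assoc p i n) m
  exact ⟨m', by rw [smul_smul, of_mul_of, hm, hm']⟩

/-- The graded localization `Q^g_κ(M)`, the sum in `Q_κ(M)` of its homogeneous parts. -/
noncomputable def gradedLocalization : Submodule (⨁ i, 𝒜 i) (Q κ (⨁ i, ℳ i)) where
  toAddSubmonoid := (⨆ n, gradedPiece κ ℳ n).toAddSubmonoid
  smul_mem' := by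
    intro c x hx
    change c • x ∈ ⨆ n, gradedPiece κ ℳ n
    change x ∈ ⨆ n, gradedPiece κ ℳ n at hx
    induction c using DirectSum.induction_on with
    | zero => rw [zero_smul]; exact zero_mem _
    | of i a =>
      induction hx using AddSubgroup.iSup_induction' with
      | hp n y hy => exact AddSubgroup.mem_iSup_of_mem (i + n) (smul_mem_gradedPiece κ ℳ a hy)
      | h1 => rw [smul_zero]; exact zero_mem _
      | hadd y z _ _ hy hz => rw [smul_add]; exact add_mem hy hz
    | add a b ha hb => rw [add_smul]; exact add_mem ha hb

theorem gradedPiece_le (n : ℤ) {q : Q κ (⨁ i, ℳ i)} (hq : q ∈ gradedPiece κ ℳ n) :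
    q ∈ gradedLocalization κ ℳ :=
  AddSubgroup.mem_iSup_of_mem (S := gradedPiece κ ℳ) n hq

theorem loc_of_mem_gradedPiece (n : ℤ) (m : ℳ n) :
    loc κ (⨁ i, ℳ i) (of ℳ n m) ∈ gradedPiece κ ℳ n :=
  ⟨⊤, Order.PFilter.top_mem, fun _ _ _ => Submodule.mem_top, fun p a _ =>
    ⟨GradedMonoid.GSMul.smul a m, by rw [← map_smul, Gmodule.of_smul_of]; rfl⟩⟩

end Graded

/-! ### Filtrations, Rees objects and associated graded objects -/

section Filtered

variable {R : Type*} [Ring R] (F : ℤ → AddSubgroup R)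
variable {M : Type*} [AddCommGroup M] [Module R M] (FM : ℤ → AddSubgroup M)

/-- The filtration is exhaustive: `⋃ F_n M = M`. -/
class IsExhaustive {M : Type*} [AddCommGroup M] (FM : ℤ → AddSubgroup M) : Prop where
  exists_mem : ∀ m, ∃ n, m ∈ FM n

/-- The filtration is separated: `⋂ F_n M = 0`. -/
def IsSeparated {M : Type*} [AddCommGroup M] (FM : ℤ → AddSubgroup M) : Prop :=
  ∀ m, (∀ n, m ∈ FM n) → m = 0

/-- `f` is a strict filtered morphism: `f (F_n M) = f (M) ∩ F_n N`. -/
def IsStrictFiltered {M N : Type*} [AddCommGroup M] [AddCommGroup N] (f : M →+ N)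
    (FM : ℤ → AddSubgroup M) (FN : ℤ → AddSubgroup N) : Prop :=
  ∀ n, (FM n).map f = f.range ⊓ FN n

/-- The filtration induced on a quotient module. -/
def inducedQuotient (N : Submodule R M) (n : ℤ) : AddSubgroup (M ⧸ N) :=
  (FM n).map N.mkQ.toAddMonoidHom

/-- The Rees ring `⨁ F_n R`, respectively the Rees module `⨁ F_n M`. -/
abbrev Rees {M : Type*} [AddCommGroup M] (FM : ℤ → AddSubgroup M) : Type _ := ⨁ n, FM n

/-- The homogeneous element of degree `n` of the Rees object given by `m ∈ F_n M`. -/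
def reesOf {M : Type*} [AddCommGroup M] (FM : ℤ → AddSubgroup M) (n : ℤ) : FM n →+ Rees FM :=
  of (fun n => FM n) n

/-- The graded part `F_n M / F_{n-1} M`. -/
def grPiece {M : Type*} [AddCommGroup M] (FM : ℤ → AddSubgroup M) (n : ℤ) : Type _ :=
  FM n ⧸ (FM (n - 1)).addSubgroupOf (FM n)

instance {M : Type*} [AddCommGroup M] (FM : ℤ → AddSubgroup M) (n : ℤ) :
    AddCommGroup (grPiece FM n) :=
  inferInstanceAs (AddCommGroup (FM n ⧸ (FM (n - 1)).addSubgroupOf (FM n)))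

/-- The class in `F_n M / F_{n-1} M` of an element of `F_n M`. -/
def grMk {M : Type*} [AddCommGroup M] (FM : ℤ → AddSubgroup M) (n : ℤ) : FM n →+ grPiece FM n :=
  QuotientAddGroup.mk' ((FM (n - 1)).addSubgroupOf (FM n))

theorem grMk_surjective {M : Type*} [AddCommGroup M] (FM : ℤ → AddSubgroup M) (n : ℤ) :
    Function.Surjective (grMk FM n) :=
  QuotientAddGroup.mk'_surjective _

theorem grMk_eq_zero {M : Type*} [AddCommGroup M] (FM : ℤ → AddSubgroup M) (n : ℤ) (m : FM n) :
    grMk FM n m = 0 ↔ (m : M) ∈ FM (n - 1) :=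
  (QuotientAddGroup.eq_zero_iff m).trans AddSubgroup.mem_addSubgroupOf

/-- The maps `F_n M → F_n M / F_{n-1} M` for all `n`, on pairs `(n, m)`. -/
def grMkSigma {M : Type*} [AddCommGroup M] (FM : ℤ → AddSubgroup M) :
    GradedMonoid (fun i => FM i) → GradedMonoid (grPiece FM) :=
  fun x => ⟨x.1, grMk FM x.1 x.2⟩

/-- The associated graded ring `G(R)`, respectively the associated graded module `G(M)`. -/
abbrev Gr {M : Type*} [AddCommGroup M] (FM : ℤ → AddSubgroup M) : Type _ := ⨁ n, grPiece FM n

/-- The homogeneous element of degree `n` of `G(M)` given by `m ∈ F_n M`. -/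
def grOf {M : Type*} [AddCommGroup M] (FM : ℤ → AddSubgroup M) (n : ℤ) : FM n →+ Gr FM :=
  (of (grPiece FM) n).comp (grMk FM n)

variable [SetLike.GradedSMul F FM]

/-- The multiplication `F_i R / F_{i-1} R × F_j M / F_{j-1} M → F_{i+j} M / F_{i+j-1} M`. -/
def grSMul (i j : ℤ) : grPiece F i →+ grPiece FM j →+ grPiece FM (i + j) :=
  QuotientAddGroup.lift _
    (AddMonoidHom.mk' (fun a : F i =>
      (QuotientAddGroup.lift _
        (AddMonoidHom.mk' (fun m : FM j =>
          grMk FM (i + j) ⟨(a : R) • (m : M), SetLike.GradedSMul.smul_mem a.2 m.2⟩)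
          (fun m m' => by
            rw [← map_add]
            congr 1
            exact Subtype.ext (smul_add _ _ _)))
        (fun m hm => by
          have h := SetLike.GradedSMul.smul_mem (A := F) (B := FM) a.2
            (AddSubgroup.mem_addSubgroupOf.mp hm)
          refine (grMk_eq_zero FM _ _).mpr ?_
          rwa [vadd_eq_add, ← add_sub_assoc] at h) :
        grPiece FM j →+ grPiece FM (i + j)))
      (fun a a' => by
        ext m
        obtain ⟨m, rfl⟩ := grMk_surjective FM j m
        refine Eq.trans ?_ (map_add (grMk FM (i + j))
          ⟨(a : R) • (m : M), SetLike.GradedSMul.smul_mem a.2 m.2⟩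
          ⟨(a' : R) • (m : M), SetLike.GradedSMul.smul_mem a'.2 m.2⟩)
        exact congrArg (grMk FM (i + j)) (Subtype.ext (add_smul (a : R) a' (m : M)))))
    (fun a ha => by
      ext m
      obtain ⟨m, rfl⟩ := grMk_surjective FM j m
      have h := SetLike.GradedSMul.smul_mem (A := F) (B := FM)
        (AddSubgroup.mem_addSubgroupOf.mp ha) m.2
      refine (grMk_eq_zero FM _ _).mpr ?_
      rwa [vadd_eq_add, sub_add_eq_add_sub] at h)

theorem grSMul_mk {i j : ℤ} (a : F i) (m : FM j) :
    grSMul F FM i j (grMk F i a) (grMk FM j m) =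
      grMk FM (i + j) ⟨(a : R) • (m : M), SetLike.GradedSMul.smul_mem a.2 m.2⟩ := rfl

variable [SetLike.GradedMonoid F]

instance : GradedMonoid.GMul (grPiece F) where
  mul {i j} a b := grSMul F F i j a b

instance : GradedMonoid.GOne (grPiece F) where
  one := grMk F 0 ⟨1, SetLike.one_mem_graded F⟩

instance : GRing (grPiece F) where
  mul_zero a := map_zero (grSMul F F _ _ a)
  zero_mul b := DFunLike.congr_fun (map_zero (grSMul F F _ _)) b
  mul_add a b c := map_add (grSMul F F _ _ a) b c
  add_mul a b c := DFunLike.congr_fun (map_add (grSMul F F _ _) a b) c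
  one_mul := by
    rintro ⟨i, a⟩
    obtain ⟨a, rfl⟩ := grMk_surjective F i a
    exact congrArg (grMkSigma F)
      (one_mul (GradedMonoid.mk i a : GradedMonoid (fun i => F i)))
  mul_one := by
    rintro ⟨i, a⟩
    obtain ⟨a, rfl⟩ := grMk_surjective F i a
    exact congrArg (grMkSigma F)
      (mul_one (GradedMonoid.mk i a : GradedMonoid (fun i => F i)))
  mul_assoc := by
    rintro ⟨i, a⟩ ⟨j, b⟩ ⟨k, c⟩
    obtain ⟨a, rfl⟩ := grMk_surjective F i a
    obtain ⟨b, rfl⟩ := grMk_surjective F j b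
    obtain ⟨c, rfl⟩ := grMk_surjective F k c
    exact congrArg (grMkSigma F)
      (mul_assoc (GradedMonoid.mk i a : GradedMonoid (fun i => F i)) (GradedMonoid.mk j b)
        (GradedMonoid.mk k c))
  natCast n := grMk F 0 ⟨n, SetLike.natCast_mem_graded F n⟩
  natCast_zero := (congrArg (grMk F 0) (Subtype.ext Nat.cast_zero)).trans (map_zero _)
  natCast_succ n := (congrArg (grMk F 0) (Subtype.ext (Nat.cast_succ n))).trans
    (map_add (grMk F 0) ⟨n, SetLike.natCast_mem_graded F n⟩ ⟨1, SetLike.one_mem_graded F⟩)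
  intCast z := grMk F 0 ⟨z, SetLike.intCast_mem_graded F z⟩
  intCast_ofNat n := congrArg (grMk F 0) (Subtype.ext (Int.cast_natCast n))
  intCast_negSucc_ofNat n := (congrArg (grMk F 0) (Subtype.ext (Int.cast_negSucc n))).trans
    (map_neg (grMk F 0) ⟨_, SetLike.natCast_mem_graded F (n + 1)⟩)

instance : Gmodule (grPiece F) (grPiece FM) where
  smul {i j} a m := grSMul F FM i j a m
  smul_zero a := map_zero (grSMul F FM _ _ a)
  zero_smul b := DFunLike.congr_fun (map_zero (grSMul F FM _ _)) b
  smul_add a b c := map_add (grSMul F FM _ _ a) b c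
  add_smul a b c := DFunLike.congr_fun (map_add (grSMul F FM _ _) a b) c
  one_smul := by
    rintro ⟨i, m⟩
    obtain ⟨m, rfl⟩ := grMk_surjective FM i m
    exact congrArg (grMkSigma FM)
      (one_smul (GradedMonoid (fun i => F i)) (GradedMonoid.mk i m))
  mul_smul := by
    rintro ⟨i, a⟩ ⟨j, b⟩ ⟨k, m⟩
    obtain ⟨a, rfl⟩ := grMk_surjective F i a
    obtain ⟨b, rfl⟩ := grMk_surjective F j b
    obtain ⟨m, rfl⟩ := grMk_surjective FM k m
    exact congrArg (grMkSigma FM)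
      (mul_smul (GradedMonoid.mk i a : GradedMonoid (fun i => F i)) (GradedMonoid.mk j b)
        (GradedMonoid.mk k m))

/-- The canonical ring morphism `π` from the Rees ring to `G(R)`. -/
def reesToGr : Rees F →+* Gr F :=
  DirectSum.toSemiring (grOf F) rfl (fun {i j} a b =>
    (of_mul_of (A := grPiece F) (grMk F i a) (grMk F j b)).symm)

theorem reesToGr_of (n : ℤ) (a : F n) : reesToGr F (reesOf F n a) = grOf F n a :=
  DirectSum.toSemiring_of _ _ _ _ _

theorem reesToGr_surjective : Function.Surjective (reesToGr F) := by
  intro y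
  induction y using DirectSum.induction_on with
  | zero => exact ⟨0, map_zero _⟩
  | of n a =>
    obtain ⟨a, rfl⟩ := grMk_surjective F n a
    exact ⟨reesOf F n a, reesToGr_of F n a⟩
  | add x y hx hy =>
    obtain ⟨x, rfl⟩ := hx
    obtain ⟨y, rfl⟩ := hy
    exact ⟨x + y, map_add _ x y⟩

/-! ### The kernel functors induced by a kernel functor on the Rees ring -/

/-- The graded left ideal `Ĩ = ⨁ (I ∩ F_n R)` of the Rees ring. -/
def tilde (I : Ideal R) : Ideal (Rees F) where
  carrier := {x | ∀ n, (x n : R) ∈ I}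
  zero_mem' := fun _ => zero_mem I
  add_mem' := fun hx hy n => add_mem (hx n) (hy n)
  smul_mem' := by
    intro c x hx n
    induction c using DirectSum.induction_on with
    | zero => rw [zero_smul]; exact zero_mem I
    | of i a =>
      obtain ⟨j, rfl⟩ : ∃ j, n = i + j := ⟨n - i, by ring⟩
      rw [smul_eq_mul, coe_of_mul_apply_add]
      exact I.mul_mem_left _ (hx j)
    | add a b ha hb => rw [add_smul]; exact add_mem ha hb

theorem mem_tilde {I : Ideal R} {x : Rees F} : x ∈ tilde F I ↔ ∀ n, (x n : R) ∈ I := Iff.rfl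

theorem tilde_colon_le (I : Ideal R) {i : ℤ} (a : F i) :
    tilde F (I.colon {(a : R)}) ≤ (tilde F I).colon {reesOf F i a} := by
  intro z hz
  rw [Submodule.mem_colon_singleton]
  intro n
  obtain ⟨j, rfl⟩ : ∃ j, n = j + i := ⟨n - i, by ring⟩
  change ((z * of (fun n => F n) i a) (j + i) : R) ∈ I
  rw [coe_mul_of_apply_add]
  exact Submodule.mem_colon_singleton.mp (hz j)

theorem colon_tilde_le (I : Ideal R) {i : ℤ} (a : F i) :
    (tilde F I).colon {reesOf F i a} ≤ tilde F (I.colon {(a : R)}) := by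
  intro z hz j
  have h := Submodule.mem_colon_singleton.mp hz (j + i)
  change ((z * of (fun n => F n) i a) (j + i) : R) ∈ I at h
  rw [coe_mul_of_apply_add] at h
  exact Submodule.mem_colon_singleton.mpr h

variable (κ : IdealFilter (Rees F))

/-- The filter `{I ⊂ R | Ĩ ∈ κ}` of the kernel functor on `R`-modules defined by a kernel functor
on modules over the Rees ring. -/
def baseFilter : IdealFilter R :=
  Order.IsPFilter.toPFilter (F := {I : Ideal R | tilde F I ∈ κ}) <| by
    refine Order.IsPFilter.of_def ⟨⊤, ?_⟩ ?_ ?_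
    · exact Order.PFilter.mem_of_le (fun _ _ _ => Submodule.mem_top) Order.PFilter.top_mem
    · intro I hI J hJ
      have h : tilde F I ⊓ tilde F J ≤ tilde F (I ⊓ J) := fun x hx n => ⟨hx.1 n, hx.2 n⟩
      exact ⟨I ⊓ J, Order.PFilter.mem_of_le h (Order.PFilter.inf_mem hI hJ), inf_le_left,
        inf_le_right⟩
    · intro I J h hI
      have h' : tilde F I ≤ tilde F J := fun x hx n => h (hx n)
      exact Order.PFilter.mem_of_le h' hI

theorem mem_baseFilter {I : Ideal R} : I ∈ baseFilter F κ ↔ tilde F I ∈ κ := Iff.rfl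

/-- The filter `{L ⊂ G(R) | L ⊃ π(I) for some I ∈ κ}` of the kernel functor on `G(R)`-modules
defined by a kernel functor on modules over the Rees ring. -/
def grFilter : IdealFilter (Gr F) :=
  Order.IsPFilter.toPFilter (F := {L : Ideal (Gr F) | ∃ I ∈ κ, I.map (reesToGr F) ≤ L}) <| by
    refine Order.IsPFilter.of_def ⟨⊤, ⊤, Order.PFilter.top_mem, le_top⟩ ?_ ?_
    · rintro L ⟨I, hI, hL⟩ K ⟨J, hJ, hK⟩
      exact ⟨L ⊓ K, ⟨I ⊓ J, Order.PFilter.inf_mem hI hJ,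
        le_inf ((Ideal.map_mono inf_le_left).trans hL) ((Ideal.map_mono inf_le_right).trans hK)⟩,
        inf_le_left, inf_le_right⟩
    · rintro L K h ⟨I, hI, hL⟩
      exact ⟨I, hI, hL.trans h⟩

theorem mem_grFilter {L : Ideal (Gr F)} :
    L ∈ grFilter F κ ↔ ∃ I ∈ κ, I.map (reesToGr F) ≤ L := Iff.rfl

theorem mem_grFilter_iff_comap {L : Ideal (Gr F)} :
    L ∈ grFilter F κ ↔ L.comap (reesToGr F) ∈ κ := by
  constructor
  · rintro ⟨I, hI, h⟩
    exact Order.PFilter.mem_of_le (Ideal.map_le_iff_le_comap.mp h) hI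
  · intro h
    exact ⟨_, h, Ideal.map_comap_le⟩

theorem colon_tilde_mem {H : Ideal R} (x : Rees F)
    (h : ∀ n, H.colon {(x n : R)} ∈ baseFilter F κ) : (tilde F H).colon {x} ∈ κ := by
  classical
  rw [← DirectSum.sum_support_of x]
  have key : ∀ s : Finset ℤ, (tilde F H).colon {∑ i ∈ s, of (fun n => F n) i (x i)} ∈ κ := by
    intro s
    induction s using Finset.induction_on with
    | empty =>
      refine Order.PFilter.mem_of_le (fun z _ => ?_) Order.PFilter.top_mem
      rw [Submodule.mem_colon_singleton, Finset.sum_empty, smul_zero]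
      exact zero_mem _
    | insert i s hi ih =>
      have hx : (tilde F H).colon {reesOf F i (x i)} ∈ κ :=
        Order.PFilter.mem_of_le (tilde_colon_le F H (x i)) (h i)
      refine Order.PFilter.mem_of_le (fun z hz => ?_) (Order.PFilter.inf_mem hx ih)
      rw [Submodule.mem_colon_singleton, Finset.sum_insert hi, smul_add]
      exact add_mem (Submodule.mem_colon_singleton.mp hz.1)
        (Submodule.mem_colon_singleton.mp hz.2)
  exact key _

variable [κ.IsGabriel]

instance [IsExhaustive F] : (baseFilter F κ).IsGabriel where
  colon_mem := by
    intro I hI r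
    obtain ⟨n, hn⟩ := IsExhaustive.exists_mem (FM := F) r
    have hI' : tilde F I ∈ κ := hI
    have h := IdealFilter.IsUniform.colon_mem hI' (reesOf F n ⟨r, hn⟩)
    exact (mem_baseFilter F κ).mpr (Order.PFilter.mem_of_le (colon_tilde_le F I ⟨r, hn⟩) h)
  gabriel_closed := by
    rintro H ⟨J, hJ, h⟩
    exact IdealFilter.IsGabriel.gabriel_closed (F := κ) (tilde F H)
      ⟨tilde F J, hJ, fun x hx => colon_tilde_mem F κ x fun n => h _ (hx n)⟩

instance : (grFilter F κ).IsGabriel where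
  colon_mem := by
    rintro L ⟨I, hI, h⟩ y
    obtain ⟨r, rfl⟩ := reesToGr_surjective F y
    rw [mem_grFilter_iff_comap]
    refine Order.PFilter.mem_of_le (fun z hz => ?_) (IdealFilter.IsUniform.colon_mem hI r)
    rw [Ideal.mem_comap, Submodule.mem_colon_singleton, smul_eq_mul, ← map_mul]
    exact h (Ideal.mem_map_of_mem _ (Submodule.mem_colon_singleton.mp hz))
  gabriel_closed := by
    rintro L ⟨K, hK, h⟩
    rw [mem_grFilter_iff_comap] at hK ⊢
    refine IdealFilter.IsGabriel.gabriel_closed _ ⟨_, hK, fun x hx => ?_⟩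
    have hx' := (mem_grFilter_iff_comap F κ).mp (h _ hx)
    refine Order.PFilter.mem_of_le (fun z hz => ?_) hx'
    have hz' := Submodule.mem_colon_singleton.mp (Ideal.mem_comap.mp hz)
    rw [smul_eq_mul, ← map_mul] at hz'
    exact Submodule.mem_colon_singleton.mpr hz'

/-- A kernel functor on modules over the Rees ring is pseudo-affine if its filter has a basis
consisting of the `Ĩ` with `I` in the filter of the induced kernel functor on `R`-modules. -/
def IsPseudoAffine (κ : IdealFilter (Rees F)) : Prop :=
  ∀ J ∈ κ, ∃ I ∈ baseFilter F κ, tilde F I ≤ J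

end Filtered

section QuotientFiltration

variable {R : Type*} [Ring R] (F : ℤ → AddSubgroup R)
variable (κ : IdealFilter R) [κ.IsGabriel]
variable {M : Type*} [AddCommGroup M] [Module R M] (FM : ℤ → AddSubgroup M)

/-- `M` is `κ`-separated: if `m ∈ F_n M - F_{n-1} M` and there is `I` in the filter of `κ` such that
`(F_γ I) m ⊂ F_{γ+n-1} M` for all `γ`, then `m ∈ κ(M)`. -/
def IsKernelSeparated : Prop :=
  ∀ n, ∀ m ∈ FM n, m ∉ FM (n - 1) →
    (∃ I ∈ κ, ∀ γ, ∀ a ∈ I, a ∈ F γ → a • m ∈ FM (γ + n - 1)) → m ∈ torsion κ M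

/-- The quotient filtration: `F_n Q_κ(M)` consists of the `q` for which there is `I` in the filter
of `κ` with `(F_p I) q ⊂ F_{p+n} (M / κ(M))` for all `p`. -/
def quotientFiltration (n : ℤ) : AddSubgroup (Q κ M) where
  carrier := {q | ∃ I ∈ κ, ∀ p, ∀ a ∈ I, a ∈ F p → ∃ m ∈ FM (p + n), a • q = loc κ M m}
  zero_mem' := ⟨⊤, Order.PFilter.top_mem, fun p a _ _ =>
    ⟨0, zero_mem _, by rw [smul_zero, map_zero]⟩⟩
  add_mem' := by
    rintro x y ⟨I, hI, hx⟩ ⟨J, hJ, hy⟩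
    refine ⟨I ⊓ J, Order.PFilter.inf_mem hI hJ, fun p a ha hp => ?_⟩
    obtain ⟨m, hm, h⟩ := hx p a ha.1 hp
    obtain ⟨m', hm', h'⟩ := hy p a ha.2 hp
    exact ⟨m + m', add_mem hm hm', by rw [smul_add, h, h', map_add]⟩
  neg_mem' := by
    rintro x ⟨I, hI, hx⟩
    refine ⟨I, hI, fun p a ha hp => ?_⟩
    obtain ⟨m, hm, h⟩ := hx p a ha hp
    exact ⟨-m, neg_mem hm, by rw [smul_neg, h, map_neg]⟩

instance [SetLike.GradedMonoid F] : SetLike.GradedSMul F (quotientFiltration F κ FM) where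
  smul_mem := by
    rintro i j r q hr ⟨I, hI, h⟩
    refine ⟨_, IdealFilter.IsUniform.colon_mem hI r, fun p a ha hp => ?_⟩
    obtain ⟨m, hm, h'⟩ := h (p + i) (a * r) (Submodule.mem_colon_singleton.mp ha)
      (SetLike.mul_mem_graded hp hr)
    exact ⟨m, by rwa [vadd_eq_add, ← add_assoc], by rw [smul_smul, h']⟩

theorem loc_mem_quotientFiltration [SetLike.GradedSMul F FM] {n : ℤ} {m : M} (hm : m ∈ FM n) :
    loc κ M m ∈ quotientFiltration F κ FM n :=
  ⟨⊤, Order.PFilter.top_mem, fun _ a _ hp =>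
    ⟨a • m, SetLike.GradedSMul.smul_mem hp hm, (map_smul _ _ _).symm⟩⟩

end QuotientFiltration

section Hypotheses

variable {R : Type*} [Ring R] (F : ℤ → AddSubgroup R) [IsRingFiltration F (fun n => F (n - 1))]

/-- The filtration is (left) Zariskian: the Rees ring is left Noetherian and `F_{-1} R` is contained
in the Jacobson radical of `F_0 R`. -/
def IsZariskian : Prop :=
  IsNoetherianRing (Rees F) ∧ ∀ r : F 0, (r : R) ∈ F (-1) → r ∈ Ring.jacobson (F 0)

/-- The central homogeneous element `X` of degree `1` of the Rees ring, given by `1 ∈ F_1 R`. -/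
def reesX : Rees F :=
  reesOf F 1 ⟨1, IsFiltration.mono (F := F) zero_le_one (SetLike.one_mem_graded F)⟩

/-- A kernel functor on modules over the Rees ring is affine if the left ideal generated by `X`
belongs to its filter. -/
def IsAffine (κ : IdealFilter (Rees F)) : Prop := Ideal.span {reesX F} ∈ κ

/-- Either `κ` is pseudo-affine and `M` is separated with respect to the induced kernel functor on
`R`-modules, or `κ` is affine and `M` modulo its torsion submodule is separated in this sense. -/
def IsLocalizable [IsExhaustive F] (κ : IdealFilter (Rees F)) [κ.IsGabriel] {M : Type*}
    [AddCommGroup M] [Module R M] (FM : ℤ → AddSubgroup M) : Prop :=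
  (IsPseudoAffine F κ ∧ IsKernelSeparated F (baseFilter F κ) FM) ∨
    (IsAffine F κ ∧ IsKernelSeparated F (baseFilter F κ)
      (inducedQuotient FM (torsion (baseFilter F κ) M)))

/-- The quotient filtration on the localization at the kernel functor on `R`-modules induced by a
kernel functor on modules over the Rees ring. -/
abbrev FQ [IsExhaustive F] (κ : IdealFilter (Rees F)) [κ.IsGabriel] {M : Type*}
    [AddCommGroup M] [Module R M] (FM : ℤ → AddSubgroup M) :
    ℤ → AddSubgroup (Q (baseFilter F κ) M) :=
  quotientFiltration F (baseFilter F κ) FM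

end Hypotheses

end FilteredLocalization

/-!
The idea is to pass from `M` to the Rees module and to the associated graded module with one
extension principle: if `g : M → N` is a map of graded modules whose kernel is the torsion of `M`,
whose cokernel is torsion and whose target is torsion-free, then `N` embeds in the graded
localization of `M`, compatibly with the canonical maps
(`exists_injective_gradedLocalization`). It is applied to the Rees map `M̃ → Q_κ(M)^∼` and to the
associated graded map `G(M) → G(Q_κ(M))` of the localization morphism. The Rees map is then
surjective onto the graded localization because a homogeneous element there can be
dehomogenized to an element of `Q_κ(M)` (`exists_dehomogenization`).

The separation hypothesis enters through `exists_loc_eq_of_smul`: in the pseudo-affine case as well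
as in the affine case, `M / κ(M)` is separated. Lowering degrees one at a time, this gives the
strictness of the localization morphism (`exists_loc_eq_of_mem_FQ`), which in turn gives
`F_a Q_κ(R) F_b Q_κ(M) ⊂ F_{a+b} Q_κ(M)` (`gradedSMul_FQ`) and the torsion-freeness of `G(Q_κ(M))`.
The quotient filtration is exhaustive because the Rees ring is left Noetherian
(`isExhaustive_FQ`).
-/

namespace FilteredLocalization

/-! ### Extending linear maps into a module of quotients -/

section Extension

variable {A : Type*} [Ring A] (κ : IdealFilter A) [κ.IsGabriel]
variable {M N P : Type*} [AddCommGroup M] [Module A M] [AddCommGroup N] [Module A N]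
  [AddCommGroup P] [Module A P]

/-- Let `S` be a submodule of `N × Q_κ(M)` that is the graph of a partial map and whose domain of
definition has torsion cokernel in `N`. The partial map extends to all of `N`, because linear maps
from left ideals of the filter to `Q_κ(M)` are given by elements. -/
theorem Q.exists_hom_of_relation (S : Submodule A (N × Q κ M)) (hS : ∀ y, (0, y) ∈ S → y = 0)
    (hdom : ∀ x : N, ∃ I ∈ κ, ∀ a ∈ I, ∃ y, (a • x, y) ∈ S) :
    ∃ φ : N →ₗ[A] Q κ M, ∀ x y, (x, y) ∈ S → φ x = y := by
  have single : ∀ {x y y'}, (x, y) ∈ S → (x, y') ∈ S → y = y' := fun h h' =>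
    sub_eq_zero.mp (hS _ (by simpa using sub_mem h h'))
  have ex : ∀ x : N, ∃ z : Q κ M, ∃ I ∈ κ, ∀ a ∈ I, (a • x, a • z) ∈ S := by
    intro x
    obtain ⟨I, hI, h⟩ := hdom x
    choose! y hy using h
    obtain ⟨z, hz⟩ := exists_smul_eq κ hI
      { toFun := fun a => y a
        map_add' := fun a b => single (hy _ (a + b).2) (by
          simpa [add_smul] using add_mem (hy _ a.2) (hy _ b.2))
        map_smul' := fun c a => single (hy _ (c • a).2) (by
          simpa [mul_smul] using S.smul_mem c (hy _ a.2)) }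
    exact ⟨z, I, hI, fun a ha => by rw [hz ⟨a, ha⟩]; exact hy a ha⟩
  have uniq : ∀ {x z z'}, (∃ I ∈ κ, ∀ a ∈ I, (a • x, a • z) ∈ S) →
      (∃ I ∈ κ, ∀ a ∈ I, (a • x, a • z') ∈ S) → z = z' := by
    rintro x z z' ⟨I, hI, h⟩ ⟨J, hJ, h'⟩
    exact eq_of_forall_smul κ (Order.PFilter.inf_mem hI hJ) fun a ha =>
      single (h a ha.1) (h' a ha.2)
  choose φ hφ using ex
  refine ⟨{ toFun := φ, map_add' := fun x x' => ?_, map_smul' := fun c x => ?_ }, ?_⟩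
  · obtain ⟨I, hI, h⟩ := hφ x
    obtain ⟨J, hJ, h'⟩ := hφ x'
    refine uniq (hφ _) ⟨_, Order.PFilter.inf_mem hI hJ, fun a ha => ?_⟩
    simpa only [smul_add, Prod.mk_add_mk] using add_mem (h a ha.1) (h' a ha.2)
  · obtain ⟨I, hI, h⟩ := hφ x
    refine uniq (hφ _) ⟨_, IdealFilter.IsUniform.colon_mem hI c, fun a ha => ?_⟩
    simpa only [RingHom.id_apply, smul_smul, smul_eq_mul] using
      h _ (Submodule.mem_colon_singleton.mp ha)
  · intro x y hxy
    exact uniq (hφ x) ⟨⊤, Order.PFilter.top_mem, fun a _ => S.smul_mem a hxy⟩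

/-- A linear map `P → Q_κ(M)` that vanishes on the kernel of `g : P → N` factors through `g` if the
cokernel of `g` is torsion. -/
theorem Q.exists_extension (g : P →ₗ[A] N) (h : P →ₗ[A] Q κ M)
    (hker : LinearMap.ker g ≤ LinearMap.ker h)
    (hcoker : ∀ x : N, ∃ I ∈ κ, ∀ a ∈ I, a • x ∈ LinearMap.range g) :
    ∃ φ : N →ₗ[A] Q κ M, φ ∘ₗ g = h := by
  obtain ⟨φ, hφ⟩ := Q.exists_hom_of_relation κ (LinearMap.range (g.prod h))
    (by
      rintro y ⟨p, hp⟩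
      obtain ⟨h0, h1⟩ := Prod.mk.inj hp
      rw [← h1]
      exact hker h0)
    (fun x => by
      obtain ⟨I, hI, hx⟩ := hcoker x
      refine ⟨I, hI, fun a ha => ?_⟩
      obtain ⟨p, hp⟩ := hx a ha
      exact ⟨h p, p, by rw [← hp]; rfl⟩)
  exact ⟨φ, LinearMap.ext fun p => hφ _ _ ⟨p, rfl⟩⟩

/-- A linear map on a torsion-free module `N` is injective if it is injective on the image of some
`g : P → N` with torsion cokernel. -/
theorem injective_of_comp {K : Type*} [AddCommGroup K] [Module A K] (g : P →ₗ[A] N)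
    (φ : N →ₗ[A] K) (hker : LinearMap.ker (φ ∘ₗ g) ≤ LinearMap.ker g)
    (hcoker : ∀ x : N, ∃ I ∈ κ, ∀ a ∈ I, a • x ∈ LinearMap.range g)
    (hN : torsion κ N = ⊥) : Function.Injective φ := by
  rw [injective_iff_map_eq_zero]
  intro x hx
  obtain ⟨I, hI, h⟩ := hcoker x
  rw [← Submodule.mem_bot A, ← hN]
  refine ⟨I, hI, fun a ha => ?_⟩
  obtain ⟨p, hp⟩ := h a ha
  rw [← hp]
  refine hker ?_
  rw [LinearMap.mem_ker, LinearMap.comp_apply, hp, map_smul, hx, smul_zero]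

end Extension

/-! ### Graded modules and graded localization -/

section GradedExtension

variable {𝒜 : ℤ → Type*} [∀ i, AddCommGroup (𝒜 i)] [GRing 𝒜]
variable {ℳ : ℤ → Type*} [∀ i, AddCommGroup (ℳ i)] [Gmodule 𝒜 ℳ]
variable {𝒩 : ℤ → Type*} [∀ i, AddCommGroup (𝒩 i)] [Gmodule 𝒜 𝒩]

theorem IsGradedIdeal.le_of_homogeneous {I L : Ideal (⨁ i, 𝒜 i)} (hI : IsGradedIdeal I)
    (h : ∀ p (a : 𝒜 p), of 𝒜 p a ∈ I → of 𝒜 p a ∈ L) : I ≤ L := by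
  classical
  intro x hx
  rw [← DirectSum.sum_support_of x]
  exact sum_mem fun p _ => h p _ (hI x hx p)

theorem IsGradedIdeal.smul_mem_of_homogeneous {N : Type*} [AddCommGroup N]
    [Module (⨁ i, 𝒜 i) N] {I : Ideal (⨁ i, 𝒜 i)} (hI : IsGradedIdeal I)
    {W : Submodule (⨁ i, 𝒜 i) N} {x : N}
    (h : ∀ p (a : 𝒜 p), of 𝒜 p a ∈ I → of 𝒜 p a • x ∈ W) : ∀ a ∈ I, a • x ∈ W :=
  hI.le_of_homogeneous (L := W.comap (LinearMap.toSpanSingleton _ N x)) h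

theorem of_smul_of {i j : ℤ} (a : 𝒜 i) (m : ℳ j) :
    of 𝒜 i a • of ℳ j m = of ℳ (i + j) (GradedMonoid.GSMul.smul a m) :=
  Gmodule.of_smul_of 𝒜 ℳ a m

theorem of_smul_apply_add {i : ℤ} (a : 𝒜 i) (x : ⨁ i, ℳ i) (j : ℤ) :
    (of 𝒜 i a • x) (i + j) = (GradedMonoid.GSMul.smul a (x j) : ℳ (i + j)) := by
  apply of_injective (β := ℳ) (i + j)
  rw [← of_smul_of]
  induction x using DirectSum.induction_on with
  | zero => simp
  | of k m =>
    by_cases h : k = j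
    · subst h
      rw [of_eq_same, of_smul_of, of_eq_same]
    · have h' : i + j ≠ i + k := fun h' => h (add_left_cancel h').symm
      rw [of_eq_of_ne _ _ _ (Ne.symm h), of_smul_of, of_eq_of_ne _ _ _ h', map_zero, map_zero,
        smul_zero]
  | add x y hx hy =>
    rw [smul_add, DirectSum.add_apply, DirectSum.add_apply, map_add, map_add, smul_add, hx, hy]

/-- The linear map between graded modules with given homogeneous components of degree zero. -/
def gradedMap (f : ∀ i, ℳ i →+ 𝒩 i)
    (hf : ∀ i j (a : 𝒜 i) (m : ℳ j), f (i + j) (GradedMonoid.GSMul.smul a m) =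
      GradedMonoid.GSMul.smul a (f j m)) : (⨁ i, ℳ i) →ₗ[⨁ i, 𝒜 i] (⨁ i, 𝒩 i) :=
  { DirectSum.map f with
    map_smul' := fun c x => by
      change DirectSum.map f (c • x) = c • DirectSum.map f x
      induction c using DirectSum.induction_on with
      | zero => rw [zero_smul, zero_smul, map_zero]
      | add a b ha hb => rw [add_smul, add_smul, map_add, ha, hb]
      | of i a =>
        induction x using DirectSum.induction_on with
        | zero => rw [smul_zero, map_zero, smul_zero]
        | add x y hx hy => rw [smul_add, map_add, map_add, smul_add, hx, hy]
        | of j m => rw [of_smul_of, map_of, map_of, of_smul_of, hf] }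

theorem gradedMap_of (f : ∀ i, ℳ i →+ 𝒩 i)
    (hf : ∀ i j (a : 𝒜 i) (m : ℳ j), f (i + j) (GradedMonoid.GSMul.smul a m) =
      GradedMonoid.GSMul.smul a (f j m)) (i : ℤ) (m : ℳ i) :
    gradedMap f hf (of ℳ i m) = of 𝒩 i (f i m) := map_of f i m

theorem gradedMap_apply (f : ∀ i, ℳ i →+ 𝒩 i)
    (hf : ∀ i j (a : 𝒜 i) (m : ℳ j), f (i + j) (GradedMonoid.GSMul.smul a m) =
      GradedMonoid.GSMul.smul a (f j m)) (x : ⨁ i, ℳ i) (i : ℤ) :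
    gradedMap f hf x i = f i (x i) := map_apply f i x

variable {κ : IdealFilter (⨁ i, 𝒜 i)} [κ.IsGabriel]

/-- The Gabriel condition needs to be tested on homogeneous elements only. -/
theorem mem_of_homogeneous_colon_mem {I H : Ideal (⨁ i, 𝒜 i)} (hI : IsGradedIdeal I)
    (hIκ : I ∈ κ)
    (h : ∀ p (a : 𝒜 p), of 𝒜 p a ∈ I → H.colon {of 𝒜 p a} ∈ κ) : H ∈ κ := by
  refine IdealFilter.IsGabriel.gabriel_closed _ ⟨I, hIκ, ?_⟩
  have key : I ≤ (torsion κ ((⨁ i, 𝒜 i) ⧸ H)).comap H.mkQ := by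
    refine hI.le_of_homogeneous fun p a ha => ⟨_, h p a ha, fun b hb => ?_⟩
    rw [← map_smul, Submodule.mkQ_apply, Submodule.Quotient.mk_eq_zero]
    exact Submodule.mem_colon_singleton.mp hb
  intro x hx
  obtain ⟨K, hK, hKx⟩ := key hx
  refine Order.PFilter.mem_of_le (fun b hb => ?_) hK
  have := hKx b hb
  rw [← map_smul, Submodule.mkQ_apply, Submodule.Quotient.mk_eq_zero] at this
  exact Submodule.mem_colon_singleton.mpr this

theorem of_apply_mem_torsion (hκ : IsGradedKernel κ) {x : ⨁ i, ℳ i}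
    (hx : x ∈ torsion κ (⨁ i, ℳ i)) (n : ℤ) : of ℳ n (x n) ∈ torsion κ (⨁ i, ℳ i) := by
  obtain ⟨J, hJ, h⟩ := hx
  obtain ⟨I, hI, gI, hIJ⟩ := hκ J hJ
  refine ⟨I, hI, fun a ha => (Submodule.mem_bot (⨁ i, 𝒜 i)).mp ?_⟩
  refine gI.smul_mem_of_homogeneous (fun p b hb => (Submodule.mem_bot _).mpr ?_) a ha
  rw [of_smul_of, ← of_smul_apply_add, h _ (hIJ hb), DirectSum.zero_apply, map_zero]

theorem mem_of_forall_of_mem {W : Submodule (⨁ i, 𝒜 i) (⨁ i, ℳ i)} {x : ⨁ i, ℳ i}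
    (h : ∀ n, of ℳ n (x n) ∈ W) : x ∈ W := by
  classical
  rw [← DirectSum.sum_support_of x]
  exact sum_mem fun n _ => h n

theorem range_le_gradedLocalization (φ : (⨁ i, 𝒩 i) →ₗ[⨁ i, 𝒜 i] Q κ (⨁ i, ℳ i))
    (h : ∀ n y, φ (of 𝒩 n y) ∈ gradedPiece κ ℳ n) (x : ⨁ i, 𝒩 i) :
    φ x ∈ gradedLocalization κ ℳ := by
  induction x using DirectSum.induction_on with
  | zero => rw [map_zero]; exact zero_mem _
  | of n y => exact gradedPiece_le κ ℳ n (h n y)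
  | add x y hx hy => rw [map_add]; exact add_mem hx hy

/-- A graded map `M → N` of degree zero whose kernel is the torsion of `M`, whose cokernel is
torsion and whose target is torsion-free makes `N` a graded submodule of the graded localization
of `M`. All three conditions are required on homogeneous elements only. -/
theorem exists_injective_gradedLocalization (hκ : IsGradedKernel κ) (f : ∀ i, ℳ i →+ 𝒩 i)
    (hf : ∀ i j (a : 𝒜 i) (m : ℳ j), f (i + j) (GradedMonoid.GSMul.smul a m) =
      GradedMonoid.GSMul.smul a (f j m))
    (hker : ∀ n (m : ℳ n), f n m = 0 ↔ of ℳ n m ∈ torsion κ (⨁ i, ℳ i))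
    (hN : ∀ n (y : 𝒩 n), of 𝒩 n y ∈ torsion κ (⨁ i, 𝒩 i) → y = 0)
    (hcoker : ∀ n (y : 𝒩 n), ∃ I ∈ κ, IsGradedIdeal I ∧ ∀ p (a : 𝒜 p), of 𝒜 p a ∈ I →
      ∃ m : ℳ (p + n), of 𝒜 p a • of 𝒩 n y = of 𝒩 (p + n) (f (p + n) m)) :
    ∃ φ : (⨁ i, 𝒩 i) →ₗ[⨁ i, 𝒜 i] gradedLocalization κ ℳ, Function.Injective φ ∧
      (∀ n (y : 𝒩 n), (φ (of 𝒩 n y)).1 ∈ gradedPiece κ ℳ n) ∧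
      (∀ n (m : ℳ n), (φ (of 𝒩 n (f n m))).1 = loc κ (⨁ i, ℳ i) (of ℳ n m)) := by
  have hker' : LinearMap.ker (gradedMap f hf) = torsion κ (⨁ i, ℳ i) := by
    ext x
    rw [LinearMap.mem_ker]
    constructor
    · intro hx
      refine mem_of_forall_of_mem fun n => (hker n _).mp ?_
      rw [← gradedMap_apply f hf, hx, DirectSum.zero_apply]
    · intro hx
      ext1 n
      rw [gradedMap_apply, DirectSum.zero_apply]
      exact (hker n _).mpr (of_apply_mem_torsion hκ hx n)
  have hloc : LinearMap.ker (loc κ (⨁ i, ℳ i)) = torsion κ (⨁ i, ℳ i) :=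
    Submodule.ext fun x => loc_eq_zero_iff κ
  have htors : torsion κ (⨁ i, 𝒩 i) = ⊥ := by
    refine (Submodule.eq_bot_iff _).mpr fun x hx => ?_
    ext1 n
    exact hN n _ (of_apply_mem_torsion hκ hx n)
  have hcoker' : ∀ x : ⨁ i, 𝒩 i, ∃ I ∈ κ, ∀ a ∈ I, a • x ∈ LinearMap.range (gradedMap f hf) := by
    intro x
    suffices h : (LinearMap.range (gradedMap f hf)).mkQ x ∈ torsion κ _ by
      obtain ⟨I, hI, h⟩ := h
      refine ⟨I, hI, fun a ha => ?_⟩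
      have := h a ha
      rwa [← map_smul, Submodule.mkQ_apply, Submodule.Quotient.mk_eq_zero] at this
    refine mem_of_forall_of_mem (W := (torsion κ _).comap (LinearMap.range (gradedMap f hf)).mkQ)
      fun n => ?_
    obtain ⟨I, hI, gI, h⟩ := hcoker n (x n)
    refine ⟨I, hI, fun a ha => ?_⟩
    rw [← map_smul, Submodule.mkQ_apply, Submodule.Quotient.mk_eq_zero]
    refine gI.smul_mem_of_homogeneous (fun p b hb => ?_) a ha
    obtain ⟨m, hm⟩ := h p b hb
    exact ⟨of ℳ _ m, by rw [hm, gradedMap_of]⟩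
  obtain ⟨φ, hφ⟩ := Q.exists_extension κ (gradedMap f hf) (loc κ (⨁ i, ℳ i))
    (by rw [hker', hloc]) hcoker'
  have hφ' : ∀ n (m : ℳ n), φ (of 𝒩 n (f n m)) = loc κ (⨁ i, ℳ i) (of ℳ n m) := fun n m => by
    rw [← hφ, LinearMap.comp_apply, gradedMap_of]
  have hpiece : ∀ n (y : 𝒩 n), φ (of 𝒩 n y) ∈ gradedPiece κ ℳ n := by
    intro n y
    obtain ⟨I, hI, gI, h⟩ := hcoker n y
    refine ⟨I, hI, gI, fun p a ha => ?_⟩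
    obtain ⟨m, hm⟩ := h p a ha
    exact ⟨m, by rw [← map_smul, hm, hφ']⟩
  refine ⟨φ.codRestrict _ (range_le_gradedLocalization φ hpiece), ?_, hpiece, hφ'⟩
  rw [LinearMap.injective_codRestrict_iff]
  exact injective_of_comp κ (gradedMap f hf) φ (by rw [hφ, hker', hloc]) hcoker' htors

end GradedExtension

/-! ### The quotient filtration -/

section Separation

variable {R : Type*} [Ring R] (F : ℤ → AddSubgroup R) [IsRingFiltration F (fun n => F (n - 1))]
variable {M : Type*} [AddCommGroup M] [Module R M] (FM : ℤ → AddSubgroup M)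


theorem isGradedIdeal_tilde (I : Ideal R) : IsGradedIdeal (𝒜 := fun n => F n) (tilde F I) := by
  intro x hx i n
  by_cases h : n = i
  · subst h
    rw [of_eq_same]
    exact hx n
  · rw [of_eq_of_ne _ _ _ h]
    exact zero_mem I

theorem reesOf_mem_tilde {I : Ideal R} {p : ℤ} {a : F p} :
    reesOf F p a ∈ tilde F I ↔ (a : R) ∈ I := by
  constructor
  · intro h
    have := h p
    rwa [reesOf, of_eq_same] at this
  · intro h n
    by_cases hn : n = p
    · subst hn
      rw [reesOf, of_eq_same]
      exact h
    · rw [reesOf, of_eq_of_ne _ _ _ hn]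
      exact zero_mem I

section Module

variable [SetLike.GradedSMul F FM]

theorem reesOf_smul_reesOf {p n : ℤ} (a : F p) (m : FM n) :
    reesOf F p a • reesOf FM n m =
      reesOf FM (p + n) ⟨(a : R) • (m : M), SetLike.GradedSMul.smul_mem a.2 m.2⟩ :=
  of_smul_of (𝒜 := fun n => F n) (ℳ := fun n => FM n) a m

theorem grOf_smul_grOf {p n : ℤ} (a : F p) (m : FM n) :
    grOf F p a • grOf FM n m =
      grOf FM (p + n) ⟨(a : R) • (m : M), SetLike.GradedSMul.smul_mem a.2 m.2⟩ :=
  of_smul_of (𝒜 := grPiece F) (ℳ := grPiece FM) (grMk F p a) (grMk FM n m)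

/-- The elements `z` of the Rees ring with `z_p m ∈ F_{p+n} M` for all `p`. -/
def transporterIdeal (n : ℤ) (m : M) : Ideal (Rees F) where
  carrier := {z | ∀ p, (z p : R) • m ∈ FM (p + n)}
  zero_mem' := fun p => by
    rw [DirectSum.zero_apply, ZeroMemClass.coe_zero, zero_smul]
    exact zero_mem _
  add_mem' := fun hx hy p => by
    rw [DirectSum.add_apply, AddSubgroup.coe_add, add_smul]
    exact add_mem (hx p) (hy p)
  smul_mem' := by
    intro c x hx p
    induction c using DirectSum.induction_on with
    | zero =>
      rw [zero_smul, DirectSum.zero_apply, ZeroMemClass.coe_zero, zero_smul]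
      exact zero_mem _
    | of i a =>
      obtain ⟨j, rfl⟩ : ∃ j, p = i + j := ⟨p - i, by ring⟩
      rw [smul_eq_mul, coe_of_mul_apply_add, mul_smul, add_assoc]
      exact SetLike.GradedSMul.smul_mem (A := F) (B := FM) a.2 (hx j)
    | add a b ha hb =>
      rw [add_smul, DirectSum.add_apply, AddSubgroup.coe_add, add_smul]
      exact add_mem ha hb

theorem reesOf_mem_transporterIdeal {n p : ℤ} {m : M} {a : F p} (h : (a : R) • m ∈ FM (p + n)) :
    reesOf F p a ∈ transporterIdeal F FM n m := by
  intro q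
  by_cases hq : q = p
  · subst hq
    rwa [reesOf, of_eq_same]
  · rw [reesOf, of_eq_of_ne _ _ _ hq, ZeroMemClass.coe_zero, zero_smul]
    exact zero_mem _

end Module

instance gradedSMul_map {N : Type*} [AddCommGroup N] [Module R N] [SetLike.GradedSMul F FM]
    (f : M →ₗ[R] N) : SetLike.GradedSMul F (fun n => (FM n).map f.toAddMonoidHom) where
  smul_mem := by
    rintro i j a _ ha ⟨m, hm, rfl⟩
    exact ⟨a • m, SetLike.GradedSMul.smul_mem ha hm, map_smul f a m⟩

instance isModuleFiltration_self : IsModuleFiltration F (fun n => F (n - 1)) F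
    (fun n => F (n - 1)) :=
  { (inferInstance : IsFiltration F (fun n => F (n - 1))) with
    smul_mem := fun _ _ _ _ ha hb => SetLike.mul_mem_graded ha hb }

variable [IsExhaustive F] {κ : IdealFilter (Rees F)} [κ.IsGabriel]
variable {FM} [IsModuleFiltration F (fun n => F (n - 1)) FM (fun n => FM (n - 1))]

/-- Under either hypothesis, `M / κ(M)` is separated with respect to the kernel functor. If `κ` is
pseudo-affine and `M` is separated, the `z` in the Rees ring with `z_p m ∈ F_{p+n-1} M`
for all `p` form a left ideal of the filter by the Gabriel condition, so they include some `J̃`. -/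
theorem exists_loc_eq_of_smul [IsExhaustive FM] (h : IsLocalizable F κ FM) {n : ℤ} {m : M}
    (hm : m ∈ FM n) {I : Ideal R} (hI : I ∈ baseFilter F κ)
    (hmI : ∀ p, ∀ a ∈ I, a ∈ F p →
      ∃ m' ∈ FM (p + n - 1), loc (baseFilter F κ) M (a • m) = loc (baseFilter F κ) M m') :
    ∃ m' ∈ FM (n - 1), loc (baseFilter F κ) M m = loc (baseFilter F κ) M m' := by
  have hloc : ∀ x y : M, loc (baseFilter F κ) M x = loc (baseFilter F κ) M y ↔
      x - y ∈ torsion (baseFilter F κ) M := fun x y => by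
    rw [← sub_eq_zero, ← map_sub, loc_eq_zero_iff]
  by_contra hcon
  obtain ⟨hpa, hsep⟩ | ⟨-, hsep⟩ := h
  · have hH : transporterIdeal F FM (n - 1) m ∈ κ := by
      refine mem_of_homogeneous_colon_mem (isGradedIdeal_tilde F I) hI fun p a ha => ?_
      obtain ⟨m', hm', hk⟩ := hmI p a ((reesOf_mem_tilde F).mp ha) a.2
      obtain ⟨K, hK, hKm⟩ := (hloc _ _).mp hk
      -- if `a m = m' + t` with `t` torsion and `K` kills `t`, then `K̃ a` lies in the ideal
      refine Order.PFilter.mem_of_le (fun z hz => ?_) ((mem_baseFilter F κ).mp hK)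
      rw [Submodule.mem_colon_singleton]
      intro q
      obtain ⟨j, rfl⟩ : ∃ j, q = j + p := ⟨q - p, by ring⟩
      rw [smul_eq_mul, coe_mul_of_apply_add, mul_smul]
      have h0 := hKm _ (hz j)
      rw [smul_sub, sub_eq_zero] at h0
      rw [h0, add_assoc, ← add_sub_assoc]
      exact SetLike.GradedSMul.smul_mem (A := F) (B := FM) (z j).2 hm'
    obtain ⟨J, hJ, hJH⟩ := hpa _ hH
    have hmn : m ∉ FM (n - 1) := fun h' => hcon ⟨m, h', rfl⟩
    have htor : m ∈ torsion (baseFilter F κ) M := hsep n m hm hmn ⟨J, hJ, fun p a ha hp => by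
      have := hJH ((reesOf_mem_tilde F (a := ⟨a, hp⟩)).mpr ha) p
      rw [reesOf, of_eq_same] at this
      rwa [add_sub_assoc]⟩
    exact hcon ⟨0, zero_mem _, by rw [map_zero, loc_eq_zero_iff]; exact htor⟩
  · have htor := hsep n ((torsion (baseFilter F κ) M).mkQ m) ⟨m, hm, rfl⟩
      (by
        rintro ⟨m', hm', h'⟩
        refine hcon ⟨m', hm', ?_⟩
        exact congrArg (Q.ofQuotient (baseFilter F κ)) h'.symm)
      ⟨I, hI, fun p a ha hp => by
        obtain ⟨m', hm', h'⟩ := hmI p a ha hp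
        exact ⟨m', hm', (Q.ofQuotient_injective (baseFilter F κ) h').symm⟩⟩
    obtain ⟨J, hJ, hJm⟩ := htor
    have h0 := eq_zero_of_torsion_quotient (baseFilter F κ) hJ hJm
    refine hcon ⟨0, zero_mem _, ?_⟩
    rw [map_zero]
    exact (congrArg (Q.ofQuotient (baseFilter F κ)) h0).trans (map_zero _)

/-- The localization morphism is strict: by separation, the degree of a representative of `j_κ(m)`
can be lowered as long as it exceeds `n`. -/
theorem exists_loc_eq_of_mem_FQ [IsExhaustive FM] (h : IsLocalizable F κ FM) {n : ℤ} {m : M}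
    (hm : loc (baseFilter F κ) M m ∈ FQ F κ FM n) :
    ∃ m' ∈ FM n, loc (baseFilter F κ) M m = loc (baseFilter F κ) M m' := by
  have mono : Monotone FM := IsFiltration.mono
  obtain ⟨I, hI, hmI⟩ := hm
  have key : ∀ k : ℕ, ∀ m' ∈ FM (n + k), loc (baseFilter F κ) M m = loc (baseFilter F κ) M m' →
      ∃ m' ∈ FM n, loc (baseFilter F κ) M m = loc (baseFilter F κ) M m' := by
    intro k
    -- descent on the excess `k` of the degree of a representative over `n`
    induction k with
    | zero => exact fun m' hm' hk => ⟨m', by simpa using hm', hk⟩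
    | succ k ih =>
      intro m' hm' hk
      obtain ⟨m'', hm'', hk'⟩ := exists_loc_eq_of_smul F h hm' hI fun p a ha hp => by
        obtain ⟨y, hy, hay⟩ := hmI p a ha hp
        refine ⟨y, mono (by push_cast; lia) hy, ?_⟩
        rw [map_smul, ← hk, hay]
      exact ih m'' (by convert hm'' using 2; push_cast; ring) (hk.trans hk')
  obtain ⟨i, hi⟩ := IsExhaustive.exists_mem (FM := FM) m
  exact key (i - n).toNat m (mono (by lia) hi) rfl

theorem isStrictFiltered_loc [IsExhaustive FM] (h : IsLocalizable F κ FM) :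
    IsStrictFiltered (loc (baseFilter F κ) M).toAddMonoidHom FM (FQ F κ FM) := by
  intro n
  ext q
  constructor
  · rintro ⟨m, hm, rfl⟩
    exact ⟨⟨m, rfl⟩, loc_mem_quotientFiltration F _ FM hm⟩
  · rintro ⟨⟨m, rfl⟩, hm⟩
    obtain ⟨m', hm', h'⟩ := exists_loc_eq_of_mem_FQ F h hm
    exact ⟨m', hm', h'.symm⟩

theorem FQ_mono : Monotone (FQ F κ FM) := by
  have mono : Monotone FM := IsFiltration.mono
  rintro n k hnk q ⟨I, hI, h⟩
  refine ⟨I, hI, fun p a ha hp => ?_⟩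
  obtain ⟨m, hm, h'⟩ := h p a ha hp
  exact ⟨m, mono (by lia) hm, h'⟩

instance isModuleFiltration_FQ :
    IsModuleFiltration F (fun n => F (n - 1)) (FQ F κ FM) (fun n => FQ F κ FM (n - 1)) :=
  { IsFiltration.mk_int _ (FQ_mono F) with
    smul_mem := fun _ _ _ _ ha hq => SetLike.GradedSMul.smul_mem ha hq }

/-- For `a x = j_κ(r)` with `r ∈ F_{p+i} R`, the element `a x y = r y` lies in `F_{p+i+j} Q_κ(M)`
since the latter is a filtered `R`-module; once it lies in the image of `M`, strictness applies. -/
theorem gradedSMul_FQ [IsExhaustive FM] (h : IsLocalizable F κ FM) :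
    SetLike.GradedSMul (FQ F κ F) (FQ F κ FM) where
  smul_mem := by
    rintro i j x y ⟨I, hI, hx⟩ hy
    obtain ⟨J, hJ, hxy⟩ := exists_smul_eq_loc (baseFilter F κ) (x • y)
    refine ⟨I ⊓ J, Order.PFilter.inf_mem hI hJ, fun p a ha hp => ?_⟩
    obtain ⟨r, hr, har⟩ := hx p a ha.1 hp
    obtain ⟨m, hm⟩ := hxy a ha.2
    have hry : a • (x • y) = r • y := by
      rw [← Q.loc_smul (baseFilter F κ) a, smul_smul, ← Q.loc_smul (baseFilter F κ) r, ← har,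
        ← Q.loc_smul (baseFilter F κ) a x, smul_eq_mul]
    have hmem : loc (baseFilter F κ) M m ∈ FQ F κ FM (p + i + j) := by
      rw [← hm, hry]
      exact SetLike.GradedSMul.smul_mem (A := F) (B := FQ F κ FM) hr hy
    obtain ⟨m', hm', h'⟩ := exists_loc_eq_of_mem_FQ F h hmem
    exact ⟨m', by rwa [vadd_eq_add, ← add_assoc], hm.trans h'⟩

/-- For `q` in `Q_κ(M)` the left ideals `{z | z_p q ∈ j_κ(F_{p+n} M) for all p}` of the Rees ring
increase with `n`; where they become stationary, `n` is a degree for `q`. -/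
theorem isExhaustive_FQ [IsExhaustive FM] [IsNoetherianRing (Rees F)] :
    IsExhaustive (FQ F κ FM) where
  exists_mem q := by
    have mono : Monotone FM := IsFiltration.mono
    obtain ⟨I, hI, hq⟩ := exists_smul_eq_loc (baseFilter F κ) q
    let G : ℤ → AddSubgroup (Q (baseFilter F κ) M) :=
      fun k => (FM k).map (loc (baseFilter F κ) M).toAddMonoidHom
    let L : ℕ →o Ideal (Rees F) :=
      { toFun := fun n => transporterIdeal F G n q
        monotone' := fun n k hnk z hz p => AddSubgroup.map_mono (mono (by lia)) (hz p) }
    obtain ⟨N, hN⟩ := monotone_stabilizes_iff_noetherian.mpr ‹_› L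
    refine ⟨N, I, hI, fun p a ha hp => ?_⟩
    obtain ⟨m, hm⟩ := hq a ha
    obtain ⟨k, hk⟩ := IsExhaustive.exists_mem (FM := FM) m
    -- the index is at least `N` and at least the degree `k - p` needed for `a`
    have hmem : reesOf F p ⟨a, hp⟩ ∈ L (max N (k - p).toNat) :=
      reesOf_mem_transporterIdeal F G ⟨m, mono (by lia) hk, hm.symm⟩
    rw [← hN _ (le_max_left _ _)] at hmem
    obtain ⟨m', hm', h'⟩ := hmem p
    rw [reesOf, of_eq_same] at h'
    exact ⟨m', hm', h'.symm⟩

theorem isRingFiltration_FQ (h : IsLocalizable F κ F) :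
    IsRingFiltration (FQ F κ F) (fun n => FQ F κ F (n - 1)) :=
  have := gradedSMul_FQ F h
  { IsFiltration.mk_int _ (FQ_mono F) with
    one_mem := loc_mem_quotientFiltration F _ F (SetLike.one_mem_graded F)
    mul_mem := fun _ _ _ _ ha hb =>
      SetLike.GradedSMul.smul_mem (A := FQ F κ F) (B := FQ F κ F) ha hb }

/-- The localization morphism of a ring, as a morphism of rings. -/
noncomputable def locRingHom {A : Type*} [Ring A] (κ : IdealFilter A) [κ.IsGabriel] : A →+* Q κ A :=
  { (loc κ A).toAddMonoidHom with
    map_one' := rfl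
    map_mul' := fun a b => by
      change loc κ A (a • b) = loc κ A a • loc κ A b
      rw [map_smul, Q.loc_smul] }

end Separation

/-! ### Torsion in Rees modules and associated graded modules -/

section ReesGr

theorem smul_eq_zero_of_forall_degree {R : Type*} [Ring R] (F : ℤ → AddSubgroup R)
    [IsExhaustive F] {I : Ideal R} {N : Type*} [AddCommGroup N] [Module R N]
    {x : N} (h : ∀ p, ∀ a ∈ I, a ∈ F p → a • x = 0) : ∀ a ∈ I, a • x = 0 := fun a ha => by
  obtain ⟨p, hp⟩ := IsExhaustive.exists_mem (FM := F) a
  exact h p a ha hp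

variable {R : Type*} [Ring R] (F : ℤ → AddSubgroup R) [IsRingFiltration F (fun n => F (n - 1))]

theorem reesToGr_apply (x : Rees F) (n : ℤ) : reesToGr F x n = grMk F n (x n) := by
  induction x using DirectSum.induction_on with
  | zero => rw [map_zero, DirectSum.zero_apply, DirectSum.zero_apply, map_zero]
  | of i a =>
    refine (DFunLike.congr_fun (reesToGr_of F i a) n).trans ?_
    by_cases h : n = i
    · subst h
      rw [of_eq_same]
      exact of_eq_same n _
    · rw [of_eq_of_ne _ _ _ h, map_zero]
      exact of_eq_of_ne _ _ _ h
  | add x y hx hy => rw [map_add, DirectSum.add_apply, DirectSum.add_apply, map_add, hx, hy]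

theorem isGradedIdeal_map_reesToGr {I : Ideal (Rees F)} (hI : IsGradedIdeal (𝒜 := fun n => F n) I) :
    IsGradedIdeal (I.map (reesToGr F)) := by
  intro y hy i
  obtain ⟨x, hx, rfl⟩ := (Ideal.mem_map_iff_of_surjective _ (reesToGr_surjective F)).mp hy
  have h : of (grPiece F) i (reesToGr F x i) = reesToGr F (reesOf F i (x i)) := by
    rw [reesToGr_apply, reesToGr_of]
    rfl
  rw [h]
  exact Ideal.mem_map_of_mem _ (hI x hx i)

theorem exists_grMk_eq {I : Ideal R} {p : ℤ} {a : grPiece F p}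
    (ha : of (grPiece F) p a ∈ (tilde F I).map (reesToGr F)) :
    ∃ b : F p, (b : R) ∈ I ∧ grMk F p b = a := by
  obtain ⟨x, hx, h⟩ := (Ideal.mem_map_iff_of_surjective _ (reesToGr_surjective F)).mp ha
  refine ⟨x p, hx p, ?_⟩
  rw [← reesToGr_apply, h, of_eq_same]

theorem isGradedKernel_grFilter {κ : IdealFilter (Rees F)}
    (hgr : IsGradedKernel (𝒜 := fun n => F n) κ) :
    IsGradedKernel (grFilter F κ) := by
  rintro L ⟨J, hJ, hJL⟩
  obtain ⟨I, hI, gI, hIJ⟩ := hgr J hJ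
  exact ⟨_, ⟨I, hI, le_rfl⟩, isGradedIdeal_map_reesToGr F gI, (Ideal.map_mono hIJ).trans hJL⟩

/-- The condition on the right is the one in the definition of separated modules: separation says
that a nonzero homogeneous torsion element of `G(M)` is the symbol of torsion elements of
`M` only. -/
theorem grOf_mem_torsion_iff {κ : IdealFilter (Rees F)} [κ.IsGabriel] {M : Type*}
    [AddCommGroup M] [Module R M] {FM : ℤ → AddSubgroup M}
    [IsModuleFiltration F (fun n => F (n - 1)) FM (fun n => FM (n - 1))]
    (hpa : IsPseudoAffine F κ) {n : ℤ} {m : FM n} :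
    grOf FM n m ∈ torsion (grFilter F κ) (Gr FM) ↔
      ∃ I ∈ baseFilter F κ, ∀ p, ∀ a ∈ I, a ∈ F p → a • (m : M) ∈ FM (p + n - 1) := by
  constructor
  · rintro ⟨L, ⟨J, hJ, hJL⟩, h⟩
    obtain ⟨I, hI, hIJ⟩ := hpa J hJ
    refine ⟨I, hI, fun p a ha hp => ?_⟩
    have haJ := hIJ ((reesOf_mem_tilde F (a := ⟨a, hp⟩)).mpr ha)
    have h0 := h _ (hJL (Ideal.mem_map_of_mem _ haJ))
    rw [reesToGr_of, grOf_smul_grOf] at h0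
    exact (grMk_eq_zero _ _ _).mp ((map_eq_zero_iff _ (of_injective (p + n))).mp h0)
  · rintro ⟨I, hI, h⟩
    refine ⟨_, ⟨tilde F I, hI, le_rfl⟩, fun a ha => (Submodule.mem_bot (Gr F)).mp ?_⟩
    refine (isGradedIdeal_map_reesToGr F (isGradedIdeal_tilde F I)).smul_mem_of_homogeneous
      (fun p b hb => ?_) a ha
    obtain ⟨b, hbI, rfl⟩ := exists_grMk_eq F hb
    refine (Submodule.mem_bot _).mpr ((grOf_smul_grOf F FM b m).trans ?_)
    exact (congrArg (of (grPiece FM) (p + n)) ((grMk_eq_zero FM _ _).mpr (h p b hbI b.2))).trans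
      (map_zero _)

variable [IsExhaustive F] {κ : IdealFilter (Rees F)} [κ.IsGabriel]
variable {M : Type*} [AddCommGroup M] [Module R M] {FM : ℤ → AddSubgroup M}
  [IsModuleFiltration F (fun n => F (n - 1)) FM (fun n => FM (n - 1))]

/-- For a pseudo-affine kernel functor, the torsion of the Rees module is the Rees module of the
torsion. -/
theorem reesOf_mem_torsion_iff (hpa : IsPseudoAffine F κ) {n : ℤ} {m : FM n} :
    reesOf FM n m ∈ torsion κ (Rees FM) ↔ (m : M) ∈ torsion (baseFilter F κ) M := by
  constructor
  · rintro ⟨J, hJ, h⟩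
    obtain ⟨I, hI, hIJ⟩ := hpa J hJ
    refine ⟨I, hI, smul_eq_zero_of_forall_degree F fun p a ha hp => ?_⟩
    have h0 := h _ (hIJ ((reesOf_mem_tilde F (a := ⟨a, hp⟩)).mpr ha))
    rw [reesOf_smul_reesOf] at h0
    exact congrArg Subtype.val ((map_eq_zero_iff _ (of_injective (p + n))).mp h0)
  · rintro ⟨I, hI, h⟩
    refine ⟨tilde F I, hI, fun a ha => (Submodule.mem_bot (Rees F)).mp ?_⟩
    refine (isGradedIdeal_tilde F I).smul_mem_of_homogeneous (fun p b hb => ?_) a ha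
    have h0 : (b : R) • (m : M) = 0 := h _ ((reesOf_mem_tilde F).mp hb)
    refine (Submodule.mem_bot _).mpr ((reesOf_smul_reesOf F FM b m).trans ?_)
    exact (congrArg (reesOf FM (p + n)) (Subtype.ext h0)).trans (map_zero _)

variable (κ FM) in
/-- The homogeneous components `F_n M → F_n Q_κ(M)` of the Rees map of the localization
morphism. -/
noncomputable def locPiece (n : ℤ) : FM n →+ FQ F κ FM n where
  toFun m := ⟨loc (baseFilter F κ) M m, loc_mem_quotientFiltration F _ FM m.2⟩
  map_zero' := Subtype.ext (map_zero _)
  map_add' _ _ := Subtype.ext (map_add _ _ _)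

variable (κ FM) in
/-- The homogeneous components `F_n M / F_{n-1} M → F_n Q_κ(M) / F_{n-1} Q_κ(M)` of the associated
graded map of the localization morphism. -/
noncomputable def grLocPiece (n : ℤ) : grPiece FM n →+ grPiece (FQ F κ FM) n :=
  QuotientAddGroup.map _ _ (locPiece F κ FM n) fun _ hm =>
    AddSubgroup.mem_comap.mpr <| AddSubgroup.mem_addSubgroupOf.mpr
      (loc_mem_quotientFiltration F _ FM (AddSubgroup.mem_addSubgroupOf.mp hm))

theorem grLocPiece_grMk (n : ℤ) (m : FM n) :
    grLocPiece F κ FM n (grMk FM n m) = grMk (FQ F κ FM) n (locPiece F κ FM n m) := rfl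

/-- The hypotheses of `exists_injective_gradedLocalization` for the Rees map of the localization
morphism need no separation. -/
theorem exists_rees_hom (hpa : IsPseudoAffine F κ) (hgr : IsGradedKernel (𝒜 := fun n => F n) κ) :
    ∃ φ : Rees (FQ F κ FM) →ₗ[Rees F] gradedLocalization κ (fun n => FM n), Function.Injective φ ∧
      (∀ n (x : FQ F κ FM n), (φ (reesOf (FQ F κ FM) n x)).1 ∈ gradedPiece κ (fun n => FM n) n) ∧
      (∀ n (m : FM n), (φ (reesOf (FQ F κ FM) n (locPiece F κ FM n m))).1 =
        loc κ (Rees FM) (reesOf FM n m)) := by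
  refine exists_injective_gradedLocalization (𝒜 := fun n => F n) (ℳ := fun n => FM n)
    (𝒩 := fun n => FQ F κ FM n) hgr (locPiece F κ FM)
    (fun i j a m => Subtype.ext (map_smul (loc (baseFilter F κ) M) (a : R) (m : M))) ?_ ?_ ?_
  · intro n m
    refine Iff.trans ?_ (reesOf_mem_torsion_iff F hpa).symm
    rw [← loc_eq_zero_iff]
    exact Subtype.ext_iff
  · intro n y hy
    obtain ⟨I, hI, h⟩ := (reesOf_mem_torsion_iff F (FM := FQ F κ FM) hpa).mp hy
    exact Subtype.ext (Q.eq_zero_of_forall_smul _ hI h)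
  · rintro n ⟨q, I, hI, h⟩
    refine ⟨tilde F I, hI, isGradedIdeal_tilde F I, fun p a ha => ?_⟩
    obtain ⟨m, hm, h'⟩ := h p a ((reesOf_mem_tilde F).mp ha) a.2
    exact ⟨⟨m, hm⟩, (reesOf_smul_reesOf F (FQ F κ FM) a _).trans
      (congrArg (reesOf (FQ F κ FM) (p + n)) (Subtype.ext h'))⟩

/-- Separation identifies the torsion of `G(M)` with the kernel of the associated graded map of the
localization morphism, and strictness makes `G(Q_κ(M))` torsion-free. -/
theorem exists_gr_hom [IsExhaustive FM] (h : IsLocalizable F κ FM) (hpa : IsPseudoAffine F κ)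
    (hgr : IsGradedKernel (𝒜 := fun n => F n) κ) :
    ∃ φ : Gr (FQ F κ FM) →ₗ[Gr F] gradedLocalization (grFilter F κ) (grPiece FM),
      Function.Injective φ ∧
      (∀ n (x : FQ F κ FM n),
        (φ (grOf (FQ F κ FM) n x)).1 ∈ gradedPiece (grFilter F κ) (grPiece FM) n) ∧
      (∀ n (m : FM n), (φ (grOf (FQ F κ FM) n (locPiece F κ FM n m))).1 =
        loc (grFilter F κ) (Gr FM) (grOf FM n m)) := by
  refine (exists_injective_gradedLocalization (𝒜 := grPiece F)
    (ℳ := grPiece FM) (𝒩 := grPiece (FQ F κ FM)) (κ := grFilter F κ)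
    (isGradedKernel_grFilter F hgr) (grLocPiece F κ FM)
    (fun i j a m => by
      obtain ⟨a, rfl⟩ := grMk_surjective F i a
      obtain ⟨m, rfl⟩ := grMk_surjective FM j m
      exact congrArg (grMk (FQ F κ FM) (i + j))
        (Subtype.ext (map_smul (loc (baseFilter F κ) M) (a : R) (m : M)) :
          locPiece F κ FM (i + j) ⟨_, SetLike.GradedSMul.smul_mem a.2 m.2⟩ =
            ⟨_, SetLike.GradedSMul.smul_mem a.2 (locPiece F κ FM j m).2⟩)) ?_ ?_ ?_).imp
      fun φ hφ => ⟨hφ.1, fun n x => hφ.2.1 n _, fun n m => hφ.2.2 n (grMk FM n m)⟩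
  · intro n m
    obtain ⟨m, rfl⟩ := grMk_surjective FM n m
    refine Iff.trans ?_ (grOf_mem_torsion_iff F hpa (m := m)).symm
    rw [grLocPiece_grMk, grMk_eq_zero]
    constructor
    · intro hm
      obtain ⟨m', hm', h'⟩ := exists_loc_eq_of_mem_FQ F h hm
      rw [← sub_eq_zero, ← map_sub, loc_eq_zero_iff] at h'
      obtain ⟨I, hI, hIm⟩ := h'
      refine ⟨I, hI, fun p a ha hp => ?_⟩
      have h0 := hIm a ha
      rw [smul_sub, sub_eq_zero] at h0
      rw [h0, add_sub_assoc]
      exact SetLike.GradedSMul.smul_mem (A := F) (B := FM) hp hm'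
    · rintro ⟨I, hI, hIm⟩
      obtain ⟨m', hm', h'⟩ := exists_loc_eq_of_smul F h m.2 hI fun p a ha hp =>
        ⟨_, hIm p a ha hp, rfl⟩
      change loc (baseFilter F κ) M m ∈ FQ F κ FM (n - 1)
      rw [h']
      exact loc_mem_quotientFiltration F _ FM hm'
  · intro n y hy
    obtain ⟨⟨q, J, hJ, hq⟩, rfl⟩ := grMk_surjective (FQ F κ FM) n y
    obtain ⟨I, hI, hIq⟩ := (grOf_mem_torsion_iff F (FM := FQ F κ FM) hpa).mp hy
    rw [grMk_eq_zero]
    refine ⟨I ⊓ J, Order.PFilter.inf_mem hI hJ, fun p a ha hp => ?_⟩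
    obtain ⟨m, -, hm⟩ := hq p a ha.2 hp
    have hmem : a • q ∈ FQ F κ FM (p + n - 1) := hIq p a ha.1 hp
    rw [hm] at hmem
    obtain ⟨m', hm', h'⟩ := exists_loc_eq_of_mem_FQ F h hmem
    exact ⟨m', by rwa [← add_sub_assoc], hm.trans h'⟩
  · intro n y
    obtain ⟨⟨q, I, hI, hq⟩, rfl⟩ := grMk_surjective (FQ F κ FM) n y
    refine ⟨_, ⟨tilde F I, hI, le_rfl⟩, isGradedIdeal_map_reesToGr F (isGradedIdeal_tilde F I),
      fun p a ha => ?_⟩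
    obtain ⟨a, haI, rfl⟩ := exists_grMk_eq F ha
    obtain ⟨m, hm, h'⟩ := hq p a haI a.2
    exact ⟨grMk FM _ ⟨m, hm⟩, (grOf_smul_grOf F (FQ F κ FM) a _).trans
      (congrArg (grOf (FQ F κ FM) (p + n)) (Subtype.ext h'))⟩

end ReesGr

/-! ### The Rees module of the localization -/

section ReesIso

variable {R : Type*} [Ring R] (F : ℤ → AddSubgroup R) [IsRingFiltration F (fun n => F (n - 1))]
  {κ : IdealFilter (Rees F)} [κ.IsGabriel]
variable {M : Type*} [AddCommGroup M] [Module R M] {FM : ℤ → AddSubgroup M}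
  [IsModuleFiltration F (fun n => F (n - 1)) FM (fun n => FM (n - 1))]

theorem reesOf_congr {M : Type*} [AddCommGroup M] {FM : ℤ → AddSubgroup M} {i j : ℤ} (h : i = j)
    {m : FM i} {m' : FM j} (hm : (m : M) = m') : reesOf FM i m = reesOf FM j m' := by
  subst h
  rw [Subtype.ext hm]

theorem reesOf_mul_reesOf {p k : ℤ} (a : F p) (b : F k) :
    reesOf F p a * reesOf F k b = reesOf F (p + k) ⟨a * b, SetLike.mul_mem_graded a.2 b.2⟩ :=
  of_mul_of (A := fun n => F n) a b

/-- Multiplying a relation `a z = j(m)` in degree `p` by a power of `X` moves it to any larger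
degree. -/
theorem smul_reesOf_eq_of_le {n p k : ℤ} (hpk : p ≤ k) {a : R} (hp : a ∈ F p) (hk : a ∈ F k)
    {m : M} (hm : m ∈ FM (p + n)) (hm' : m ∈ FM (k + n)) {z : Q κ (Rees FM)}
    (h : reesOf F p ⟨a, hp⟩ • z = loc κ (Rees FM) (reesOf FM (p + n) ⟨m, hm⟩)) :
    reesOf F k ⟨a, hk⟩ • z = loc κ (Rees FM) (reesOf FM (k + n) ⟨m, hm'⟩) := by
  obtain ⟨i, rfl⟩ : ∃ i, k = i + p := ⟨k - p, by ring⟩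
  have h1 : (1 : R) ∈ F i :=
    (IsFiltration.mono (F := F) (by lia : 0 ≤ i)) (SetLike.one_mem_graded F)
  have ha : reesOf F (i + p) ⟨a, hk⟩ = reesOf F i ⟨1, h1⟩ * reesOf F p ⟨a, hp⟩ := by
    rw [reesOf_mul_reesOf]
    exact reesOf_congr rfl (one_mul a).symm
  rw [ha, mul_smul, h, ← map_smul, reesOf_smul_reesOf]
  exact congrArg _ (reesOf_congr (add_assoc i p n).symm (one_smul R m))

variable [IsExhaustive F]

/-- A homogeneous element `z` of the graded localization of the Rees module is dehomogenized to the
element `q` of `Q_κ(M)` with `a q = j_κ(m)` whenever `a z = j(m)` in some degree. -/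
theorem exists_dehomogenization (hpa : IsPseudoAffine F κ) {n : ℤ} {z : Q κ (Rees FM)}
    (hz : z ∈ gradedPiece κ (fun n => FM n) n) :
    ∃ q : Q (baseFilter F κ) M, ∃ I ∈ baseFilter F κ, ∀ p (a : F p), (a : R) ∈ I →
      ∃ m : FM (p + n), (a : R) • q = loc (baseFilter F κ) M m ∧
        reesOf F p a • z = loc κ (Rees FM) (reesOf FM (p + n) m) := by
  have mono : Monotone FM := IsFiltration.mono
  have monoF : Monotone F := IsFiltration.mono
  obtain ⟨J, hJ, -, hJz⟩ := hz
  obtain ⟨I, hI, hIJ⟩ := hpa J hJ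
  have hIz : ∀ p (a : F p), (a : R) ∈ I → ∃ m : FM (p + n),
      reesOf F p a • z = loc κ (Rees FM) (reesOf FM (p + n) m) := fun p a ha =>
    hJz p a (hIJ ((reesOf_mem_tilde F).mpr ha))
  -- the graph of the partial map `a ↦ j_κ(m)`, where `a z = j(m)` in some degree `p`
  let S : Submodule R (R × Q (baseFilter F κ) M) :=
    { carrier := {x | ∃ p, ∃ ha : x.1 ∈ F p, ∃ m : FM (p + n),
        reesOf F p ⟨x.1, ha⟩ • z = loc κ (Rees FM) (reesOf FM (p + n) m) ∧
          loc (baseFilter F κ) M m = x.2}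
      zero_mem' := ⟨0, zero_mem _, 0, by
        rw [show (⟨(0 : R × Q (baseFilter F κ) M).1, zero_mem _⟩ : F 0) = 0 from rfl, map_zero,
          map_zero, zero_smul, map_zero], map_zero _⟩
      add_mem' := by
        rintro ⟨a, _⟩ ⟨b, _⟩ ⟨p, ha, m, hm, rfl⟩ ⟨k, hb, m', hm', rfl⟩
        have ha' := monoF (le_max_left p k) ha
        have hb' := monoF (le_max_right p k) hb
        have h1 := smul_reesOf_eq_of_le F (le_max_left p k) ha ha' m.2
          (mono (by lia) m.2) hm
        have h2 := smul_reesOf_eq_of_le F (le_max_right p k) hb hb' m'.2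
          (mono (by lia) m'.2) hm'
        refine ⟨max p k, add_mem ha' hb',
          ⟨m + m', add_mem (mono (by lia) m.2) (mono (by lia) m'.2)⟩, ?_,
          map_add (loc (baseFilter F κ) M) (m : M) m'⟩
        · refine Eq.trans ?_ ((congrArg₂ (· + ·) h1 h2).trans ?_)
          · rw [← add_smul, ← map_add]; rfl
          · rw [← map_add, ← map_add]; rfl
      smul_mem' := by
        rintro c ⟨a, _⟩ ⟨p, ha, m, hm, rfl⟩
        obtain ⟨i, hi⟩ := IsExhaustive.exists_mem (FM := F) c
        refine ⟨i + p, SetLike.mul_mem_graded hi ha, ⟨c • (m : M), ?_⟩, ?_,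
          map_smul (loc (baseFilter F κ) M) c (m : M)⟩
        · rw [add_assoc]
          exact SetLike.GradedSMul.smul_mem (A := F) (B := FM) hi m.2
        · have h1 : reesOf F (i + p) ⟨c * a, SetLike.mul_mem_graded hi ha⟩ =
              reesOf F i ⟨c, hi⟩ * reesOf F p ⟨a, ha⟩ :=
            (reesOf_mul_reesOf F ⟨c, hi⟩ ⟨a, ha⟩).symm
          refine (congrArg (· • z) h1).trans ?_
          rw [mul_smul, hm, ← map_smul, reesOf_smul_reesOf]
          exact congrArg _ (reesOf_congr (add_assoc i p n).symm rfl) }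
  obtain ⟨φ, hφ⟩ := Q.exists_hom_of_relation (baseFilter F κ) S
    (by
      rintro y ⟨p, ha, m, hm, rfl⟩
      rw [show (⟨((0 : R), loc (baseFilter F κ) M m).1, ha⟩ : F p) = 0 from rfl, map_zero,
        zero_smul, eq_comm, loc_eq_zero_iff, reesOf_mem_torsion_iff F hpa] at hm
      exact (loc_eq_zero_iff _).mpr hm)
    (fun x => ⟨_, IdealFilter.IsUniform.colon_mem hI x, fun a ha => by
      obtain ⟨p, hp⟩ := IsExhaustive.exists_mem (FM := F) (a • x)
      obtain ⟨m, hm⟩ := hIz p ⟨_, hp⟩ (Submodule.mem_colon_singleton.mp ha)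
      exact ⟨_, p, hp, m, hm, rfl⟩⟩)
  refine ⟨φ 1, I, hI, fun p a ha => ?_⟩
  obtain ⟨m, hm⟩ := hIz p a ha
  refine ⟨m, ?_, hm⟩
  rw [← map_smul, smul_eq_mul, mul_one]
  exact hφ _ _ ⟨p, a.2, m, hm, rfl⟩

theorem exists_rees_equiv (hpa : IsPseudoAffine F κ)
    (hgr : IsGradedKernel (𝒜 := fun n => F n) κ) :
    ∃ e : Rees (FQ F κ FM) ≃ₗ[Rees F] gradedLocalization κ (fun n => FM n),
      (∀ n (x : FQ F κ FM n), (e (reesOf (FQ F κ FM) n x)).1 ∈ gradedPiece κ (fun n => FM n) n) ∧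
      (∀ n, ∀ y ∈ gradedPiece κ (fun n => FM n) n,
        ∃ x : FQ F κ FM n, (e (reesOf (FQ F κ FM) n x)).1 = y) ∧
      (∀ n (m : FM n), (e (reesOf (FQ F κ FM) n (locPiece F κ FM n m))).1 =
        loc κ (Rees FM) (reesOf FM n m)) := by
  obtain ⟨φ, hinj, hpiece, hloc⟩ := exists_rees_hom F (FM := FM) hpa hgr
  have hpre : ∀ n, ∀ y ∈ gradedPiece κ (fun n => FM n) n,
      ∃ x : FQ F κ FM n, (φ (reesOf (FQ F κ FM) n x)).1 = y := by
    intro n y hy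
    obtain ⟨q, I, hI, h⟩ := exists_dehomogenization F hpa hy
    have hq : q ∈ FQ F κ FM n := ⟨I, hI, fun p a ha hp => by
      obtain ⟨m, hm, -⟩ := h p ⟨a, hp⟩ ha
      exact ⟨m, m.2, hm⟩⟩
    refine ⟨⟨q, hq⟩, sub_eq_zero.mp (Q.eq_zero_of_forall_smul κ hI fun a ha => ?_)⟩
    rw [← Submodule.mem_bot (Rees F)]
    refine (isGradedIdeal_tilde F I).smul_mem_of_homogeneous (fun p b hb => ?_) a ha
    obtain ⟨m, hm, hm'⟩ := h p b ((reesOf_mem_tilde F).mp hb)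
    rw [Submodule.mem_bot, smul_sub, sub_eq_zero]
    change reesOf F p b • _ = reesOf F p b • _
    rw [hm', ← hloc, ← Submodule.coe_smul, ← map_smul, reesOf_smul_reesOf]
    congr 3
    exact Subtype.ext hm
  have hsurj : Function.Surjective φ := by
    rintro ⟨y, hy⟩
    change y ∈ ⨆ n, gradedPiece κ (fun n => FM n) n at hy
    suffices h : ∃ x, (φ x).1 = y from h.imp fun x hx => Subtype.ext hx
    induction hy using AddSubgroup.iSup_induction' with
    | hp n y hy => exact (hpre n y hy).imp' _ fun x hx => hx
    | h1 => exact ⟨0, by rw [map_zero]; rfl⟩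
    | hadd y y' _ _ hy hy' =>
      obtain ⟨x, rfl⟩ := hy
      obtain ⟨x', rfl⟩ := hy'
      exact ⟨x + x', by rw [map_add]; rfl⟩
  exact ⟨LinearEquiv.ofBijective φ ⟨hinj, hsurj⟩, hpiece, hpre, hloc⟩

end ReesIso

end FilteredLocalization

open FilteredLocalization in
theorem mainTheorem2 {R : Type*} [Ring R] (F : ℤ → AddSubgroup R)
    [IsRingFiltration F (fun n => F (n - 1))] [IsExhaustive F] (hFsep : IsSeparated F)
    (hZar : IsZariskian F)
    {M : Type*} [AddCommGroup M] [Module R M] (FM : ℤ → AddSubgroup M)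
    [IsModuleFiltration F (fun n => F (n - 1)) FM (fun n => FM (n - 1))] [IsExhaustive FM]
    (hMsep : IsSeparated FM)
    (κ : IdealFilter (Rees F)) [κ.IsGabriel] (hgr : IsGradedKernel (𝒜 := fun n => F n) κ) :
    -- the quotient filtration on the module of quotients of `M`
    (IsLocalizable F κ FM →
      IsModuleFiltration F (fun n => F (n - 1)) (FQ F κ FM) (fun n => FQ F κ FM (n - 1)) ∧
      IsExhaustive (FQ F κ FM) ∧
      IsStrictFiltered (loc (baseFilter F κ) M).toAddMonoidHom FM (FQ F κ FM) ∧
      SetLike.GradedSMul (FQ F κ F) (FQ F κ FM)) ∧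
    -- the quotient filtration on the ring of quotients of `R`
    (IsLocalizable F κ F →
      IsRingFiltration (FQ F κ F) (fun n => FQ F κ F (n - 1)) ∧
      IsExhaustive (FQ F κ F) ∧
      IsStrictFiltered (loc (baseFilter F κ) R).toAddMonoidHom F (FQ F κ F) ∧
      ∃ j : R →+* Q (baseFilter F κ) R, ∀ r, j r = loc (baseFilter F κ) R r) ∧
    -- the Rees module of the localization is the graded localization of the Rees module
    (IsLocalizable F κ FM → IsPseudoAffine F κ →
      ∃ e : Rees (FQ F κ FM) ≃ₗ[Rees F] gradedLocalization κ (fun n => FM n),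
        (∀ n (x : FQ F κ FM n),
          (e (reesOf (FQ F κ FM) n x)).1 ∈ gradedPiece κ (fun n => FM n) n) ∧
        (∀ n, ∀ y ∈ gradedPiece κ (fun n => FM n) n,
          ∃ x : FQ F κ FM n, (e (reesOf (FQ F κ FM) n x)).1 = y) ∧
        (∀ n (m : FM n), (e (reesOf (FQ F κ FM) n
          ⟨loc (baseFilter F κ) M m, loc_mem_quotientFiltration F _ FM m.2⟩)).1 =
            loc κ (Rees FM) (reesOf FM n m))) ∧
    -- the associated graded module of the localization embeds in the graded localization
    (IsLocalizable F κ FM → IsPseudoAffine F κ →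
      ∃ φ : Gr (FQ F κ FM) →ₗ[Gr F] gradedLocalization (grFilter F κ) (grPiece FM),
        Function.Injective φ ∧
        (∀ n (x : FQ F κ FM n),
          (φ (grOf (FQ F κ FM) n x)).1 ∈ gradedPiece (grFilter F κ) (grPiece FM) n) ∧
        (∀ n (m : FM n), (φ (grOf (FQ F κ FM) n
          ⟨loc (baseFilter F κ) M m, loc_mem_quotientFiltration F _ FM m.2⟩)).1 =
            loc (grFilter F κ) (Gr FM) (grOf FM n m))) := by
  have := hZar.1
  refine ⟨fun h => ⟨isModuleFiltration_FQ F, isExhaustive_FQ F, isStrictFiltered_loc F h,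
    gradedSMul_FQ F h⟩, fun h => ⟨isRingFiltration_FQ F h, isExhaustive_FQ F,
    isStrictFiltered_loc F h, locRingHom _, fun _ => rfl⟩, fun _ hpa => ?_, fun h hpa => ?_⟩
  · exact exists_rees_equiv F hpa hgr
  · exact exists_gr_hom F h hpa hgr
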